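/- Notation. For probabilities $P,Q$ on a measurable space $(E,\mathcal E)$ let $h^2(P,Q)=\frac12\int(\sqrt{dP/d\nu}-\sqrt{dQ/d\nu})^2d\nu$ ($\nu$ any measure dominating $P$ and $Q$) be the squared Hellinger distance. Let $\mu$ be a $\sigma$-finite measure on $(E,\mathcal E)$, $k,n\ge 1$ integers, and $\mathcal M=\{P_\theta=p_\theta\cdot\mu,\ \theta\in\mathbb R^k\}$ a family of probabilities such that $(x,\theta)\mapsto p_\theta(x)\in[0,\infty)$ is measurable and $p_\theta=p_{\theta'}$ whenever $P_\theta=P_{\theta'}$ (one version of the density is fixed for each element of $\mathcal M$). Let $R>0$, $\alpha\in(0,1]$ and $B_k>0$ satisfy $RB_k^{1/(2\alpha)}\ge1$ and $$h(P_\theta,P_{\theta'})\le\sqrt{B_k}\,|\theta-\theta'|_\infty^\alpha\quad\text{for all }\theta,\theta'\in\mathbb R^k\text{ with }|\theta|_\infty\vee|\theta'|_\infty\le R .$$ Endow $\mathcal M$ with the Borel $\sigma$-algebra of the Hellinger distance. Prior. For $m\subset\{1,\dots,k\}$ let $\Theta_m(R)$ be the set of $\theta\in\mathbb R^k$ with $|\theta|_\infty\le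 R$ and $\theta_i=0$ for $i\notin m$, let $\nu_m$ be the uniform distribution on $\Theta_m(R)$ (the Dirac mass at $0$ if $m=\varnothing$) and $\pi_m$ the image of $\nu_m$ by $\theta\mapsto P_\theta$. Put $\pi=\sum_{m\subset\{1,\dots,k\}}e^{-L_m}\pi_m$ with $L_m=|m|\log k+k\log(1+1/k)$. Posterior. Let $\psi(x)=(x-1)/(x+1)$ for $x\in[0,\infty)$, $\psi(\infty)=1$, and for $P=p\cdot\mu$, $Q=q\cdot\mu$ in $\mathcal M$ let $t_{(P,Q)}=\frac12\psi(\sqrt{q/p})$ (with $0/0=1$ and $x/0=\infty$ for $x>0$). Let $\beta=1/500$, $c=1/125$, $\lambda=(1+c)\beta$. For $X=(X_1,\dots,X_n)\in E^n$ put $T(X,P,Q)=\sum_{i=1}^nt_{(P,Q)}(X_i)$, $$T(X,P)=\frac{\int_{\mathcal M}T(X,P,Q)\,e^{\lambda T(X,P,Q)}\,d\pi(Q)}{\int_{\mathcal M}e^{\lambda T(X,P,Q)}\,d\pi(Q)},\qquad \frac{d\widehat\pi_X}{d\pi}(P)=\frac{e^{-\beta T(X,P)}}{\int_{\mathcal M}e^{-\beta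 T(X,P')}\,d\pi(P')} .$$ Statement. There is a numerical constant $\kappa_0'>0$ (depending on none of the above) such that, in every such setting, $\pi$ and $\widehat\pi_X$ (for every $X\in E^n$) are probabilities on $\mathcal M$ and, whenever $X_1,\dots,X_n$ are independent with arbitrary distributions $P_1^\star,\dots,P_n^\star$ on $(E,\mathcal E)$ and $\overline P^\star=\frac1n\sum_{i=1}^nP_i^\star$, for every $\xi>0$ the mapping $X\mapsto\widehat\pi_X(\{Q\in\mathcal M:\ h^2(\overline P^\star,Q)>\kappa_0'r\})$ is measurable and $$\mathbb E\left[\widehat\pi_X\left(\{Q\in\mathcal M:\ h^2(\overline P^\star,Q)>\kappa_0'r\}\right)\right]\le2e^{-\xi},$$ where $$r=\inf_{m\subset\{1,\dots,k\}}\left[\inf_{\theta\in\Theta_m(R)}h^2(\overline P^\star,P_\theta)+\frac{|m|\log\left(2kR(nB_k)^{1/(2\alpha)}\right)+\xi}{n}\right].$$ -/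

import Mathlib

open MeasureTheory Set
open scoped NNReal ENNReal

noncomputable section

namespace SparsePosterior

/-! ### The squared Hellinger distance -/

/-- The squared Hellinger distance
`h²(P, Q) = (1/2) ∫ (√(dP/dν) - √(dQ/dν))² dν`, with the dominating measure `ν = P + Q`
(the value does not depend on the dominating measure). -/
def sqHellinger {E : Type*} [MeasurableSpace E] (P Q : Measure E) : ℝ :=
  (1 / 2) * ∫ x, (√(P.rnDeriv (P + Q) x).toReal - √(Q.rnDeriv (P + Q) x).toReal) ^ 2 ∂(P + Q)

/-- The Hellinger distance `h(P, Q)`. -/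
def hellinger {E : Type*} [MeasurableSpace E] (P Q : Measure E) : ℝ :=
  √(sqHellinger P Q)

/-! ### The posterior distribution attached to a family of test functions -/

section Posterior

variable {E M : Type*} [MeasurableSpace M] {n : ℕ}

/-- `T(X, P, Q) = ∑ᵢ t_(P,Q)(Xᵢ)`. -/
def testStat (t : M → M → E → ℝ) (x : Fin n → E) (P Q : M) : ℝ :=
  ∑ i, t P Q (x i)

/-- The probability `π̃_X(· | P)` with density
`Q ↦ exp(λ T(X, P, Q)) / ∫ exp(λ T(X, P, Q)) dπ(Q)` with respect to the prior `π`. -/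
def tildePosterior (t : M → M → E → ℝ) (π : Measure M) (lam : ℝ) (x : Fin n → E) (P : M) :
    Measure M :=
  π.withDensity fun Q => ENNReal.ofReal
    (Real.exp (lam * testStat t x P Q) / ∫ Q', Real.exp (lam * testStat t x P Q') ∂π)

/-- `T(X, P) = ∫ T(X, P, Q) dπ̃_X(Q | P)`. -/
def meanTestStat (t : M → M → E → ℝ) (π : Measure M) (lam : ℝ) (x : Fin n → E) (P : M) : ℝ :=
  ∫ Q, testStat t x P Q ∂(tildePosterior t π lam x P)

/-- The posterior `π̂_X`, with density `P ↦ exp(-β T(X, P)) / ∫ exp(-β T(X, P)) dπ(P)`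
with respect to the prior `π`, where `λ = (1 + c) β`. -/
def posterior (t : M → M → E → ℝ) (π : Measure M) (β c : ℝ) (x : Fin n → E) : Measure M :=
  π.withDensity fun P => ENNReal.ofReal
    (Real.exp (-β * meanTestStat t π ((1 + c) * β) x P) /
      ∫ P', Real.exp (-β * meanTestStat t π ((1 + c) * β) x P') ∂π)

end Posterior

/-! ### The test functions for the squared Hellinger loss -/

/-- `ψ(x) = (x - 1) / (x + 1)` for `x ∈ [0, ∞)` and `ψ(∞) = 1`. -/
def psi (x : ℝ≥0∞) : ℝ :=
  if x = ⊤ then 1 else (x.toReal - 1) / (x.toReal + 1)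

/-- The ratio `q / p` with the conventions `0 / 0 = 1` and `q / 0 = ∞` for `q > 0`. -/
def ratio (q p : ℝ≥0) : ℝ≥0∞ :=
  if p = 0 then (if q = 0 then 1 else ⊤) else (q : ℝ≥0∞) / (p : ℝ≥0∞)

/-! ### The parametric model `{P_θ = p_θ · μ, θ ∈ ℝ^k}` -/

section Model

variable {E : Type*} [MeasurableSpace E] {k : ℕ}

/-- `P_θ = p_θ · μ`. -/
def law (μ : Measure E) (p : (Fin k → ℝ) → E → ℝ≥0) (θ : Fin k → ℝ) : Measure E :=
  μ.withDensity fun x => (p θ x : ℝ≥0∞)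

/-- The model `ℳ = {P_θ, θ ∈ ℝ^k}`, as a set of measures. -/
def Model (μ : Measure E) (p : (Fin k → ℝ) → E → ℝ≥0) : Type _ :=
  ↥(Set.range (law μ p))

variable {μ : Measure E} {p : (Fin k → ℝ) → E → ℝ≥0}

/-- The measure on `E` underlying a point of the model. -/
def Model.toMeasure (P : Model μ p) : Measure E := P.1

/-- The mapping `θ ↦ P_θ` with values in the model. -/
def Model.point (μ : Measure E) (p : (Fin k → ℝ) → E → ℝ≥0) (θ : Fin k → ℝ) : Model μ p :=
  ⟨law μ p θ, Set.mem_range_self θ⟩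

/-- A version of the density `dP/dμ` of a point `P` of the model: `p_θ` for some `θ` with
`P_θ = P`. -/
def Model.density (P : Model μ p) : E → ℝ≥0 :=
  p P.2.choose

/-- The topology of the Hellinger distance on the model: `U` is open when it contains an open
Hellinger ball around each of its points. -/
instance : TopologicalSpace (Model μ p) where
  IsOpen U := ∀ P ∈ U, ∃ ε : ℝ, 0 < ε ∧
    ∀ Q : Model μ p, hellinger P.toMeasure Q.toMeasure < ε → Q ∈ U
  isOpen_univ := fun _ _ => ⟨1, one_pos, fun _ _ => trivial⟩
  isOpen_inter := by
    intro s t hs ht P hP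
    obtain ⟨ε, hε, h⟩ := hs P hP.1
    obtain ⟨δ, hδ, h'⟩ := ht P hP.2
    exact ⟨min ε δ, lt_min hε hδ, fun Q hQ =>
      ⟨h Q (hQ.trans_le (min_le_left _ _)), h' Q (hQ.trans_le (min_le_right _ _))⟩⟩
  isOpen_sUnion := by
    rintro S hS P ⟨s, hs, hP⟩
    obtain ⟨ε, hε, h⟩ := hS s hs P hP
    exact ⟨ε, hε, fun Q hQ => ⟨s, hs, h Q hQ⟩⟩

/-- The Borel `σ`-algebra of the Hellinger distance. -/
instance : MeasurableSpace (Model μ p) := borel _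

/-- The test function `t_(P,Q) = (1/2) ψ(√(q/p))`, where `P = p · μ` and `Q = q · μ`. -/
def hellingerTest (P Q : Model μ p) (x : E) : ℝ :=
  (1 / 2) * psi (ratio (Q.density x) (P.density x) ^ (1 / 2 : ℝ))

/-- The closed ball `{Q ∈ ℳ, h²(S, Q) ≤ r}`. -/
def hBall (μ : Measure E) (p : (Fin k → ℝ) → E → ℝ≥0) (S : Measure E) (r : ℝ) :
    Set (Model μ p) :=
  {Q | sqHellinger S Q.toMeasure ≤ r}

end Model

/-! ### The sparsity prior -/

section Prior

variable {k : ℕ}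

/-- `Θ_m(R)`: the points `θ` of `ℝ^k` with `|θ|_∞ ≤ R` (sup norm) whose coordinates outside `m`
vanish. -/
def thetaCube (m : Finset (Fin k)) (R : ℝ) : Set (Fin k → ℝ) :=
  {θ | (∀ i, i ∉ m → θ i = 0) ∧ ‖θ‖ ≤ R}

/-- Extension by zero of a vector indexed by `m` to a vector of `ℝ^k`. -/
def extendZero (m : Finset (Fin k)) (u : m → ℝ) : Fin k → ℝ :=
  fun i => if h : i ∈ m then u ⟨i, h⟩ else 0

/-- The uniform distribution `ν_m` on the cube `Θ_m(R)`: the image under extension by zero of the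
uniform distribution on `[-R, R]^m` (the Dirac mass at `0` when `m` is empty). -/
def uniformCube (m : Finset (Fin k)) (R : ℝ) : Measure (Fin k → ℝ) :=
  (ProbabilityTheory.cond (volume : Measure (m → ℝ))
    (Set.Icc (fun _ => -R) (fun _ => R))).map (extendZero m)

/-- `L_m = |m| log k + k log (1 + 1/k)`. -/
def penalty (m : Finset (Fin k)) : ℝ :=
  (m.card : ℝ) * Real.log k + (k : ℝ) * Real.log (1 + 1 / (k : ℝ))

/-- The prior `π = ∑_m exp(-L_m) π_m`, where `π_m` is the image of `ν_m` by `θ ↦ P_θ`. -/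
def prior {E : Type*} [MeasurableSpace E] (μ : Measure E) (p : (Fin k → ℝ) → E → ℝ≥0) (R : ℝ) :
    Measure (Model μ p) :=
  ∑ m : Finset (Fin k),
    ENNReal.ofReal (Real.exp (-penalty m)) • (uniformCube m R).map (Model.point μ p)

end Prior

/-- The average `P̄* = (1/n) ∑ᵢ Pᵢ*` of the marginal distributions. -/
def average {E : Type*} [MeasurableSpace E] {n : ℕ} (Ps : Fin n → Measure E) : Measure E :=
  (n : ℝ≥0∞)⁻¹ • ∑ i, Ps i

/-- The radius `r = inf_m [ inf_{θ ∈ Θ_m(R)} h²(P̄*, P_θ)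
  + (|m| log (2 k R (n B)^{1/(2α)}) + ξ) / n ]`. -/
def radius {E : Type*} [MeasurableSpace E] {k n : ℕ} (μ : Measure E)
    (p : (Fin k → ℝ) → E → ℝ≥0) (R α B : ℝ) (Ps : Fin n → Measure E) (ξ : ℝ) : ℝ :=
  ⨅ m : Finset (Fin k),
    ((⨅ θ : thetaCube m R, sqHellinger (average Ps) (law μ p θ.1)) +
      ((m.card : ℝ) * Real.log (2 * k * R * ((n : ℝ) * B) ^ (1 / (2 * α))) + ξ) / n)

end SparsePosterior

end

/-! Write `ℓ(P) = h²(P̄*, P)`. The argument rests on two moment bounds for the tests under the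
average law: the mean of `t_(P,Q)` is at most `3 ℓ(P) - ℓ(Q)/4`, and its second moment is at most
`ℓ(P) + ℓ(Q)` (`integral_contrast_le`). They come from pointwise inequalities between `√p`, `√q` and
the square root of the true density, so `P̄*` need not be dominated by `μ`. As `exp u ≤ 1 + u + u²`
for `|u| ≤ 1`, independence turns them into bounds on exponential moments of `T(X, P, Q)`.

Let `B` be a set where `ℓ ≤ r₀`. Jensen's inequality bounds `exp(b T(X, P))` by a ratio of two
exponential integrals over the prior, and Cauchy–Schwarz on `B` replaces the reciprocal of the lower
one by `π(B)⁻²` times an integral. What remains is a double integral of exponentials of `T(X, P, Q)`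
and `T(X, Q', P)`, with `Q'` in `B`, whose expectation is computed by Fubini
(`lintegral_exp_mul_meanTestStat_le`). With `b = -β` this controls the numerator of the posterior
mass of a set where `ℓ` is large: the gain `-λ/4` in front of `ℓ(P)` beats the loss `3(λ - β) =
3cβ`. With `b = β`, after a second use of Cauchy–Schwarz, it controls the reciprocal of the
denominator. The two are combined in `lintegral_posterior_le`, at a cost governed by `log (1/π(B))`
and `n r₀`.

For the sparsity prior, `B` contains the image of a sup-norm cube of radius `δ = (nB_k)^(-1/(2α))`
around a nearly optimal `θ` in `Θ_m(R)`. On this cube the squared Hellinger distance to `P_θ` is at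
most `1/n`, and the prior mass is at least `exp(-|m| log(2kR/δ) - 1)` (`le_prior_apply`).

Measurability needs a separate argument, since the density attached to a point of the model comes
from an arbitrary choice of parameter. The map `θ ↦ P_θ` is continuous on the compact ball of radius
`R`, whose image carries the prior, so it has a Borel section `σ` there
(`exists_measurable_section`). Replacing the tests by those between `p_(σ P)` and `p_(σ Q)` leaves
the posterior unchanged and makes everything jointly measurable. -/

noncomputable section

namespace SparsePosterior

/-! ### Pointwise inequalities for the Hellinger test -/

/-- The function `(u, v) ↦ (v - u) / (v + u)`, which is `ψ(v / u)`. -/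
def contrast (u v : ℝ) : ℝ := (v - u) / (v + u)

theorem contrast_antisymm (u v : ℝ) : contrast v u = -contrast u v := by
  unfold contrast
  rw [add_comm u v, ← neg_div, neg_sub]

theorem abs_contrast_le_one {u v : ℝ} (hu : 0 ≤ u) (hv : 0 ≤ v) : |contrast u v| ≤ 1 := by
  unfold contrast
  rw [abs_div, abs_of_nonneg (add_nonneg hv hu)]
  refine div_le_one_of_le₀ ?_ (add_nonneg hv hu)
  rw [abs_le]
  constructor <;> linarith

theorem contrast_mul {c : ℝ} (hc : c ≠ 0) (u v : ℝ) :
    contrast (c * u) (c * v) = contrast u v := by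
  unfold contrast
  rw [← mul_sub, ← mul_add, mul_div_mul_left _ _ hc]

/-- Case `w = 1` of a homogeneous inequality. The term in `v² - u²` is harmless: it integrates to
zero when `u²` and `v²` are probability densities. -/
theorem contrast_le {u v : ℝ} (hu : 0 ≤ u) (hv : 0 ≤ v) :
    contrast u v ≤ 3 * (1 - u) ^ 2 - 1 / 4 * (1 - v) ^ 2 + 1 / 4 * (v ^ 2 - u ^ 2) := by
  -- The right side is `11/4 (1-u)² + (v-u)/2`, and `(v-u)(2-u-v) = (1-u)² - (1-v)²`. Multiplied by
  -- `2(u+v)`, the claim reads `(1-u)² - (1-v)² ≤ 11/2 (u+v)(1-u)²`, clear once `u + v ≥ 2/11`.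
  -- Otherwise `u ≤ 2/11` and the right side exceeds `1`.
  rcases le_total (2 / 11) (u + v) with h | h
  · have hpos : 0 < v + u := by linarith
    unfold contrast
    rw [div_le_iff₀ hpos]
    nlinarith [mul_nonneg (sub_nonneg.2 h) (sq_nonneg (1 - u)), sq_nonneg (1 - v),
      mul_nonneg (sub_nonneg.2 h) (sq_nonneg (1 - v))]
  · have := (abs_le.1 (abs_contrast_le_one hu hv)).2
    nlinarith

theorem sq_mul_contrast_le {u v w : ℝ} (hu : 0 ≤ u) (hv : 0 ≤ v) (hw : 0 ≤ w) :
    w ^ 2 * contrast u v ≤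
      3 * (w - u) ^ 2 - 1 / 4 * (w - v) ^ 2 + 1 / 4 * (v ^ 2 - u ^ 2) := by
  rcases hw.eq_or_lt with rfl | hw
  · nlinarith [sq_nonneg u, sq_nonneg v]
  · have h := contrast_le (div_nonneg hu hw.le) (div_nonneg hv hw.le)
    have h1 : contrast (u / w) (v / w) = contrast u v := by
      rw [← contrast_mul hw.ne' (u / w) (v / w), mul_div_cancel₀ _ hw.ne',
        mul_div_cancel₀ _ hw.ne']
    rw [h1] at h
    calc w ^ 2 * contrast u v ≤ w ^ 2 * _ := mul_le_mul_of_nonneg_left h (sq_nonneg w)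
      _ = _ := by field_simp

theorem sq_contrast_le {u v : ℝ} (hu : 0 ≤ u) (hv : 0 ≤ v) :
    contrast u v ^ 2 ≤ 2 * ((1 - u) ^ 2 + (1 - v) ^ 2) := by
  rcases le_total 1 (u + v) with h | h
  · have hpos : 0 < v + u := by linarith
    unfold contrast
    rw [div_pow, div_le_iff₀ (by positivity)]
    have h1 : (v - u) ^ 2 ≤ 2 * ((1 - u) ^ 2 + (1 - v) ^ 2) := by nlinarith [sq_nonneg (2 - u - v)]
    have h2 : 1 ≤ (v + u) ^ 2 := by nlinarith
    exact h1.trans (le_mul_of_one_le_right (by positivity) h2)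
  · have := (sq_le_one_iff_abs_le_one _).2 (abs_contrast_le_one hu hv)
    nlinarith [sq_nonneg (u - v)]

theorem sq_mul_sq_contrast_le {u v w : ℝ} (hu : 0 ≤ u) (hv : 0 ≤ v) (hw : 0 ≤ w) :
    w ^ 2 * contrast u v ^ 2 ≤ 2 * ((w - u) ^ 2 + (w - v) ^ 2) := by
  rcases hw.eq_or_lt with rfl | hw
  · nlinarith [sq_nonneg u, sq_nonneg v]
  · have h := sq_contrast_le (div_nonneg hu hw.le) (div_nonneg hv hw.le)
    have h1 : contrast (u / w) (v / w) = contrast u v := by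
      rw [← contrast_mul hw.ne' (u / w) (v / w), mul_div_cancel₀ _ hw.ne',
        mul_div_cancel₀ _ hw.ne']
    rw [h1] at h
    calc w ^ 2 * contrast u v ^ 2 ≤ w ^ 2 * _ := mul_le_mul_of_nonneg_left h (sq_nonneg w)
      _ = _ := by field_simp

theorem psi_sqrt_ratio (q p : ℝ≥0) :
    psi (ratio q p ^ (1 / 2 : ℝ)) = contrast √(p : ℝ) √(q : ℝ) := by
  unfold psi ratio contrast
  by_cases hp : p = 0
  · by_cases hq : q = 0
    · simp [hp, hq]
    · have : √(q : ℝ) ≠ 0 := by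
        rw [Real.sqrt_ne_zero']
        exact_mod_cast pos_iff_ne_zero.2 hq
      simp [hp, hq, this]
  · have hp' : 0 < √(p : ℝ) := Real.sqrt_pos.2 (by exact_mod_cast pos_iff_ne_zero.2 hp)
    have hfin : ((q : ℝ≥0∞) / (p : ℝ≥0∞)) ^ (1 / 2 : ℝ) ≠ ⊤ :=
      ENNReal.rpow_ne_top_of_nonneg (by norm_num)
        (ENNReal.div_ne_top ENNReal.coe_ne_top (by exact_mod_cast hp))
    rw [if_neg hp, if_neg hfin, ← ENNReal.toReal_rpow, ENNReal.toReal_div, ENNReal.coe_toReal,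
      ENNReal.coe_toReal, ← Real.sqrt_eq_rpow, Real.sqrt_div' _ (NNReal.coe_nonneg p)]
    change (√(q : ℝ) / √(p : ℝ) - 1) / (√(q : ℝ) / √(p : ℝ) + 1) = _
    have h2 : 0 < √(q : ℝ) + √(p : ℝ) := by positivity
    field_simp

theorem hellingerTest_eq {E : Type*} [MeasurableSpace E] {k : ℕ} {μ : Measure E}
    {p : (Fin k → ℝ) → E → ℝ≥0} (P Q : Model μ p) (x : E) :
    hellingerTest P Q x = 1 / 2 * contrast √(P.density x : ℝ) √(Q.density x : ℝ) := by
  rw [hellingerTest, psi_sqrt_ratio]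

/-! ### The Hellinger distance computed with a dominating measure -/

section Hellinger

variable {E : Type*} [MeasurableSpace E]

theorem rnDeriv_mul_ae_eq {ν : Measure E} [SigmaFinite ν] {P T : Measure E} [IsFiniteMeasure P]
    [IsFiniteMeasure T] (hPT : P ≪ T) {a : E → ℝ≥0∞} (ha : Measurable a)
    (hP : P = ν.withDensity a) :
    ∀ᵐ x ∂ν, P.rnDeriv T x * T.rnDeriv ν x = a x := by
  have h1 := Measure.rnDeriv_mul_rnDeriv (κ := ν) hPT
  have h2 := Measure.rnDeriv_withDensity ν ha
  rw [← hP] at h2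
  filter_upwards [h1, h2] with x h1 h2
  rw [← h2, ← h1, Pi.mul_apply]

theorem sqHellinger_eq {ν : Measure E} [SigmaFinite ν] {P Q : Measure E} [IsFiniteMeasure P]
    [IsFiniteMeasure Q] {a b : E → ℝ≥0∞} (ha : Measurable a) (hb : Measurable b)
    (hP : P = ν.withDensity a) (hQ : Q = ν.withDensity b) :
    sqHellinger P Q = 1 / 2 * ∫ x, (√(a x).toReal - √(b x).toReal) ^ 2 ∂ν := by
  have hPν : P ≪ ν := hP ▸ withDensity_absolutelyContinuous _ _
  have hQν : Q ≪ ν := hQ ▸ withDensity_absolutelyContinuous _ _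
  have hν : P + Q ≪ ν := Measure.AbsolutelyContinuous.add_left hPν hQν
  have hPT : P ≪ P + Q := Measure.absolutelyContinuous_of_le (Measure.le_add_right le_rfl)
  have hQT : Q ≪ P + Q := Measure.absolutelyContinuous_of_le (Measure.le_add_left le_rfl)
  unfold sqHellinger
  congr 1
  rw [← integral_rnDeriv_smul hν]
  refine integral_congr_ae ?_
  filter_upwards [rnDeriv_mul_ae_eq hPT ha hP, rnDeriv_mul_ae_eq hQT hb hQ] with x h1 h2
  rw [← h1, ← h2, ENNReal.toReal_mul, ENNReal.toReal_mul, Real.sqrt_mul ENNReal.toReal_nonneg,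
    Real.sqrt_mul ENNReal.toReal_nonneg, ← sub_mul, mul_pow, Real.sq_sqrt ENNReal.toReal_nonneg,
    smul_eq_mul, mul_comm]

theorem integrable_sq_sub_sqrt {ν : Measure E} {a b : E → ℝ≥0∞} (ha : Measurable a)
    (hb : Measurable b) (hai : ∫⁻ x, a x ∂ν ≠ ⊤) (hbi : ∫⁻ x, b x ∂ν ≠ ⊤) :
    Integrable (fun x => (√(a x).toReal - √(b x).toReal) ^ 2) ν := by
  refine Integrable.mono' ((integrable_toReal_of_lintegral_ne_top ha.aemeasurable hai).add
    (integrable_toReal_of_lintegral_ne_top hb.aemeasurable hbi))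
    (by fun_prop) (Filter.Eventually.of_forall fun x => ?_)
  rw [Real.norm_of_nonneg (sq_nonneg _), Pi.add_apply]
  have h1 := Real.sq_sqrt (ENNReal.toReal_nonneg (a := a x))
  have h2 := Real.sq_sqrt (ENNReal.toReal_nonneg (a := b x))
  nlinarith [mul_nonneg (Real.sqrt_nonneg (a x).toReal) (Real.sqrt_nonneg (b x).toReal)]

theorem sqHellinger_nonneg (P Q : Measure E) : 0 ≤ sqHellinger P Q :=
  mul_nonneg (by norm_num) (integral_nonneg fun _ => sq_nonneg _)

theorem hellinger_sq (P Q : Measure E) : hellinger P Q ^ 2 = sqHellinger P Q :=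
  Real.sq_sqrt (sqHellinger_nonneg P Q)

theorem lintegral_density_ne_top {ν P : Measure E} [IsFiniteMeasure P] {a : E → ℝ≥0∞}
    (hP : P = ν.withDensity a) : ∫⁻ x, a x ∂ν ≠ ⊤ := by
  have := measure_ne_top P univ
  rwa [hP, withDensity_apply _ MeasurableSet.univ, setLIntegral_univ] at this

theorem exists_density (ν : Measure E) [SigmaFinite ν] {P : Measure E} [IsFiniteMeasure P]
    (h : P ≪ ν) : ∃ a : E → ℝ≥0∞, Measurable a ∧ P = ν.withDensity a :=
  ⟨P.rnDeriv ν, Measure.measurable_rnDeriv _ _, (Measure.withDensity_rnDeriv_eq _ _ h).symm⟩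

theorem sqHellinger_le_two_mul_add (S P Q : Measure E) [IsFiniteMeasure S] [IsFiniteMeasure P]
    [IsFiniteMeasure Q] :
    sqHellinger S Q ≤ 2 * sqHellinger S P + 2 * sqHellinger P Q := by
  obtain ⟨ν, hν, hS, hP, hQ⟩ : ∃ ν : Measure E, SigmaFinite ν ∧ S ≪ ν ∧ P ≪ ν ∧ Q ≪ ν :=
    ⟨S + P + Q, inferInstance, Measure.absolutelyContinuous_of_le
      ((Measure.le_add_right le_rfl).trans (Measure.le_add_right le_rfl)),
      Measure.absolutelyContinuous_of_le
      ((Measure.le_add_left le_rfl).trans (Measure.le_add_right le_rfl)),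
      Measure.absolutelyContinuous_of_le (Measure.le_add_left le_rfl)⟩
  obtain ⟨s, hs, hs'⟩ := exists_density _ hS
  obtain ⟨a, ha, ha'⟩ := exists_density _ hP
  obtain ⟨b, hb, hb'⟩ := exists_density _ hQ
  have is := lintegral_density_ne_top hs'
  have ia := lintegral_density_ne_top ha'
  have ib := lintegral_density_ne_top hb'
  rw [sqHellinger_eq hs hb hs' hb', sqHellinger_eq hs ha hs' ha', sqHellinger_eq ha hb ha' hb',
    mul_left_comm, mul_left_comm 2, ← mul_add]
  refine mul_le_mul_of_nonneg_left ?_ (by norm_num)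
  rw [← integral_const_mul, ← integral_const_mul, ← integral_add
    ((integrable_sq_sub_sqrt hs ha is ia).const_mul 2)
    ((integrable_sq_sub_sqrt ha hb ia ib).const_mul 2)]
  refine integral_mono (integrable_sq_sub_sqrt hs hb is ib)
    (((integrable_sq_sub_sqrt hs ha is ia).const_mul 2).add
    ((integrable_sq_sub_sqrt ha hb ia ib).const_mul 2)) fun x => ?_
  dsimp only
  nlinarith [sq_nonneg ((√(s x).toReal - √(a x).toReal) - (√(a x).toReal - √(b x).toReal))]

theorem contrast_sqrt_mul {f : ℝ} (hf : 0 < f) (a b : ℝ) :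
    contrast √(f * a) √(f * b) = contrast √a √b := by
  rw [Real.sqrt_mul hf.le, Real.sqrt_mul hf.le, contrast_mul (Real.sqrt_pos.2 hf).ne']

/-- Here `s` and `f` stand for the densities of `S` and `μ` with respect to a common dominating
measure. Where `f > 0`, the contrast is unchanged when `a`, `b` become `f a`, `f b`; where `f = 0`,
a region that `S` may charge, the bound `contrast ≤ 1` suffices. -/
theorem mul_contrast_sqrt_le {s f a b : ℝ} (hs : 0 ≤ s) (hf : 0 ≤ f) (ha : 0 ≤ a) (hb : 0 ≤ b) :
    s * contrast √a √b ≤ 3 * (√s - √(f * a)) ^ 2 - 1 / 4 * (√s - √(f * b)) ^ 2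
      + 1 / 4 * (f * b - f * a) := by
  rcases hf.eq_or_lt with rfl | hf'
  · simp only [zero_mul, Real.sqrt_zero, sub_zero, Real.sq_sqrt hs]
    have := (abs_le.1 (abs_contrast_le_one (Real.sqrt_nonneg a) (Real.sqrt_nonneg b))).2
    nlinarith
  · have h := sq_mul_contrast_le (Real.sqrt_nonneg (f * a)) (Real.sqrt_nonneg (f * b))
      (Real.sqrt_nonneg s)
    rwa [contrast_sqrt_mul hf', Real.sq_sqrt hs, Real.sq_sqrt (mul_nonneg hf hb),
      Real.sq_sqrt (mul_nonneg hf ha)] at h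

theorem mul_sq_contrast_sqrt_le {s f a b : ℝ} (hs : 0 ≤ s) (hf : 0 ≤ f) :
    s * contrast √a √b ^ 2 ≤ 2 * ((√s - √(f * a)) ^ 2 + (√s - √(f * b)) ^ 2) := by
  rcases hf.eq_or_lt with rfl | hf'
  · simp only [zero_mul, Real.sqrt_zero, sub_zero, Real.sq_sqrt hs]
    have := (sq_le_one_iff_abs_le_one _).2
      (abs_contrast_le_one (Real.sqrt_nonneg a) (Real.sqrt_nonneg b))
    nlinarith
  · have h := sq_mul_sq_contrast_le (Real.sqrt_nonneg (f * a)) (Real.sqrt_nonneg (f * b))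
      (Real.sqrt_nonneg s)
    rwa [contrast_sqrt_mul hf', Real.sq_sqrt hs] at h

theorem measurable_contrast : Measurable fun z : ℝ × ℝ => contrast z.1 z.2 := by
  unfold contrast
  fun_prop

theorem measurable_contrast_sqrt {a b : E → ℝ≥0} (ha : Measurable a) (hb : Measurable b) :
    Measurable fun x => contrast √(a x : ℝ) √(b x : ℝ) :=
  measurable_contrast.comp
    (ha.coe_nnreal_real.sqrt.prodMk hb.coe_nnreal_real.sqrt)

theorem abs_contrast_sqrt_le_one (a b : ℝ) : |contrast √a √b| ≤ 1 :=
  abs_contrast_le_one (Real.sqrt_nonneg _) (Real.sqrt_nonneg _)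

/-- Densities with respect to a common dominating measure of a finite measure `S` and of the
measures with a density with respect to `μ`. -/
theorem exists_common_density (S μ : Measure E) [IsFiniteMeasure S] [SigmaFinite μ] :
    ∃ (ν : Measure E) (s f : E → ℝ≥0∞), SigmaFinite ν ∧ Measurable s ∧ Measurable f ∧
      S = ν.withDensity s ∧ (∀ᵐ x ∂ν, s x < ⊤) ∧
      ∀ a : E → ℝ≥0, Measurable a →
        μ.withDensity (fun x => (a x : ℝ≥0∞)) = ν.withDensity fun x => f x * a x := by
  have hS : S ≪ S + μ := Measure.absolutelyContinuous_of_le (Measure.le_add_right le_rfl)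
  have hμ : μ ≪ S + μ := Measure.absolutelyContinuous_of_le (Measure.le_add_left le_rfl)
  refine ⟨S + μ, S.rnDeriv (S + μ), μ.rnDeriv (S + μ), inferInstance,
    Measure.measurable_rnDeriv _ _, Measure.measurable_rnDeriv _ _,
    (Measure.withDensity_rnDeriv_eq _ _ hS).symm, Measure.rnDeriv_lt_top _ _, fun a ha => ?_⟩
  conv_lhs => rw [← Measure.withDensity_rnDeriv_eq _ _ hμ]
  rw [← withDensity_mul _ (Measure.measurable_rnDeriv _ _) ha.coe_nnreal_ennreal]
  rfl

/-- Integration of the pointwise bounds: each integrated square is twice a squared Hellinger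
distance, and the linear term cancels because both densities have mass one. -/
theorem integral_contrast_le {S μ : Measure E} [IsProbabilityMeasure S] [SigmaFinite μ]
    {a b : E → ℝ≥0} (ha : Measurable a) (hb : Measurable b)
    [hP : IsProbabilityMeasure (μ.withDensity fun x => (a x : ℝ≥0∞))]
    [hQ : IsProbabilityMeasure (μ.withDensity fun x => (b x : ℝ≥0∞))] :
    ∫ x, contrast √(a x : ℝ) √(b x : ℝ) ∂S ≤
        6 * sqHellinger S (μ.withDensity fun x => (a x : ℝ≥0∞))
          - 1 / 2 * sqHellinger S (μ.withDensity fun x => (b x : ℝ≥0∞)) ∧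
      ∫ x, contrast √(a x : ℝ) √(b x : ℝ) ^ 2 ∂S ≤
        4 * (sqHellinger S (μ.withDensity fun x => (a x : ℝ≥0∞))
          + sqHellinger S (μ.withDensity fun x => (b x : ℝ≥0∞))) := by
  obtain ⟨ν, s, f, hν, hs, hf, hS, hsfin, hd⟩ := exists_common_density S μ
  have hfa : Measurable fun x => f x * (a x : ℝ≥0∞) := hf.mul ha.coe_nnreal_ennreal
  have hfb : Measurable fun x => f x * (b x : ℝ≥0∞) := hf.mul hb.coe_nnreal_ennreal
  have is := lintegral_density_ne_top hS
  have ia := lintegral_density_ne_top (hd a ha)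
  have ib := lintegral_density_ne_top (hd b hb)
  have one : ∀ {c : E → ℝ≥0∞}, Measurable c → IsProbabilityMeasure (ν.withDensity c) →
      ∫ x, (c x).toReal ∂ν = 1 := by
    intro c hc h
    have h1 : ∫⁻ x, c x ∂ν = 1 := by
      rw [← setLIntegral_univ, ← withDensity_apply _ MeasurableSet.univ]
      exact h.measure_univ
    rw [integral_toReal hc.aemeasurable (ae_lt_top hc (by simp [h1])), h1, ENNReal.toReal_one]
  have hS1 : ∀ g : E → ℝ, ∫ x, g x ∂S = ∫ x, (s x).toReal * g x ∂ν := by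
    intro g
    rw [hS, integral_withDensity_eq_integral_toReal_smul hs hsfin]
    rfl
  have hmeas := measurable_contrast_sqrt ha hb
  have I1 := integrable_sq_sub_sqrt hs hfa is ia
  have I2 := integrable_sq_sub_sqrt hs hfb is ib
  have J1 := integrable_toReal_of_lintegral_ne_top hfa.aemeasurable ia
  have J2 := integrable_toReal_of_lintegral_ne_top hfb.aemeasurable ib
  have Js := integrable_toReal_of_lintegral_ne_top hs.aemeasurable is
  have K1 : Integrable (fun x => (s x).toReal * contrast √(a x : ℝ) √(b x : ℝ)) ν :=
    Js.mul_bdd hmeas.aestronglyMeasurable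
      (Filter.Eventually.of_forall fun x => abs_contrast_sqrt_le_one _ _)
  have K2 : Integrable (fun x => (s x).toReal * contrast √(a x : ℝ) √(b x : ℝ) ^ 2) ν :=
    Js.mul_bdd (hmeas.pow_const 2).aestronglyMeasurable
      (Filter.Eventually.of_forall fun x => by
        rw [Real.norm_of_nonneg (sq_nonneg _)]
        exact (sq_le_one_iff_abs_le_one _).2 (abs_contrast_sqrt_le_one _ _))
  rw [hS1, hS1, sqHellinger_eq hs hfa hS (hd a ha), sqHellinger_eq hs hfb hS (hd b hb)]
  constructor
  · have h := integral_mono K1 (((I1.const_mul 3).sub (I2.const_mul (1 / 4))).add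
      ((J2.sub J1).const_mul (1 / 4))) fun x => by
        have := mul_contrast_sqrt_le (s := (s x).toReal) (f := (f x).toReal)
          ENNReal.toReal_nonneg ENNReal.toReal_nonneg (a x).2 (b x).2
        simpa [ENNReal.toReal_mul] using this
    rw [integral_add' ((I1.const_mul 3).sub (I2.const_mul (1 / 4)))
      ((J2.sub J1).const_mul (1 / 4)), integral_sub' (I1.const_mul 3) (I2.const_mul (1 / 4)),
      integral_const_mul, integral_const_mul, integral_const_mul, integral_sub' J2 J1,
      one hfa (hd a ha ▸ hP), one hfb (hd b hb ▸ hQ)] at h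
    linarith
  · have h := integral_mono K2 ((I1.add I2).const_mul 2) fun x => by
        have := mul_sq_contrast_sqrt_le (s := (s x).toReal) (f := (f x).toReal)
          (a := a x) (b := b x) ENNReal.toReal_nonneg ENNReal.toReal_nonneg
        simpa [ENNReal.toReal_mul] using this
    rw [integral_const_mul, integral_add' I1 I2] at h
    linarith

end Hellinger

/-! ### Exponential moments -/

section Moments

variable {E : Type*} [MeasurableSpace E]

theorem integrable_of_abs_le {μ : Measure E} [IsFiniteMeasure μ] {f : E → ℝ} (hf : Measurable f)
    {C : ℝ} (hC : ∀ x, |f x| ≤ C) : Integrable f μ :=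
  Integrable.of_bound hf.aestronglyMeasurable C (Filter.Eventually.of_forall hC)

theorem integrable_exp_of_abs_le {μ : Measure E} [IsFiniteMeasure μ] {f : E → ℝ}
    (hf : Measurable f) {C : ℝ} (hC : ∀ x, |f x| ≤ C) : Integrable (fun x => Real.exp (f x)) μ :=
  integrable_of_abs_le hf.exp (C := Real.exp C) fun x => by
    rw [abs_of_pos (Real.exp_pos _)]
    exact Real.exp_le_exp.2 (abs_le.1 (hC x)).2

theorem exp_integral_le {μ : Measure E} [IsProbabilityMeasure μ] {f : E → ℝ}
    (hf : Integrable f μ) (hexp : Integrable (fun x => Real.exp (f x)) μ) :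
    Real.exp (∫ x, f x ∂μ) ≤ ∫ x, Real.exp (f x) ∂μ :=
  convexOn_exp.map_integral_le Real.continuous_exp.continuousOn isClosed_univ
    (Filter.Eventually.of_forall fun _ => mem_univ _) hf hexp

theorem integral_exp_le {μ : Measure E} [IsProbabilityMeasure μ] {u : E → ℝ} (hu : Measurable u)
    (hb : ∀ x, |u x| ≤ 1) :
    ∫ x, Real.exp (u x) ∂μ ≤ Real.exp (∫ x, (u x + u x ^ 2) ∂μ) := by
  have hb2 : ∀ x, |u x ^ 2| ≤ 1 := fun x => by
    rw [abs_of_nonneg (sq_nonneg _)]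
    exact (sq_le_one_iff_abs_le_one _).2 (hb x)
  have i1 := integrable_of_abs_le (μ := μ) hu hb
  have i2 := integrable_of_abs_le (μ := μ) (hu.pow_const 2) hb2
  have i3 : Integrable (fun x => u x + u x ^ 2) μ := i1.add i2
  have h : ∫ x, Real.exp (u x) ∂μ ≤ ∫ x, (1 + (u x + u x ^ 2)) ∂μ := by
    refine integral_mono (integrable_exp_of_abs_le hu hb)
      ((integrable_const 1).add i3) fun x => ?_
    have := (abs_le.1 (Real.abs_exp_sub_one_sub_id_le (hb x))).2
    dsimp only
    linarith
  rw [integral_add (integrable_const 1) i3] at h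
  simp only [integral_const, probReal_univ, smul_eq_mul, mul_one] at h
  refine h.trans ?_
  rw [add_comm]
  exact Real.add_one_le_exp _

theorem integral_average {n : ℕ} (Ps : Fin n → Measure E) [∀ i, IsProbabilityMeasure (Ps i)]
    {g : E → ℝ} (hg : ∀ i, Integrable g (Ps i)) :
    ∫ x, g x ∂(average Ps) = (n : ℝ)⁻¹ * ∑ i, ∫ x, g x ∂(Ps i) := by
  rw [average, integral_smul_measure, integral_finsetSum_measure fun i _ => hg i]
  simp

theorem isProbabilityMeasure_average {n : ℕ} (hn : 1 ≤ n) (Ps : Fin n → Measure E)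
    [∀ i, IsProbabilityMeasure (Ps i)] : IsProbabilityMeasure (average Ps) := by
  constructor
  rw [average, Measure.smul_apply, Measure.finsetSum_apply]
  simp only [measure_univ, Finset.sum_const, Finset.card_univ, Fintype.card_fin, nsmul_eq_mul,
    mul_one, smul_eq_mul]
  exact ENNReal.inv_mul_cancel (by exact_mod_cast (by omega : n ≠ 0)) (ENNReal.natCast_ne_top n)

theorem lintegral_exp_sum_le {n : ℕ} (hn : 1 ≤ n) (Ps : Fin n → Measure E)
    [∀ i, IsProbabilityMeasure (Ps i)] {u : E → ℝ} (hu : Measurable u) (hb : ∀ x, |u x| ≤ 1) :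
    ∫⁻ x : Fin n → E, ENNReal.ofReal (Real.exp (∑ i, u (x i))) ∂(Measure.pi Ps) ≤
      ENNReal.ofReal (Real.exp (n * ∫ x, (u x + u x ^ 2) ∂(average Ps))) := by
  have hsum : ∀ x : Fin n → E, |∑ i, u (x i)| ≤ n := fun x => by
    refine (Finset.abs_sum_le_sum_abs _ _).trans ?_
    refine (Finset.sum_le_sum fun i _ => hb (x i)).trans ?_
    simp
  rw [← ofReal_integral_eq_lintegral_ofReal
    (integrable_exp_of_abs_le (by fun_prop) hsum)
    (Filter.Eventually.of_forall fun x => (Real.exp_pos _).le)]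
  refine ENNReal.ofReal_le_ofReal ?_
  simp only [Real.exp_sum]
  rw [integral_fintype_prod_eq_prod (fun (_ : Fin n) (y : E) => Real.exp (u y)),
    integral_average, ← mul_assoc, mul_inv_cancel₀ (by positivity), one_mul, Real.exp_sum]
  · exact Finset.prod_le_prod (fun i _ => integral_nonneg fun x => (Real.exp_pos _).le)
      fun i _ => integral_exp_le hu hb
  · refine fun i => (integrable_of_abs_le hu hb).add (integrable_of_abs_le (hu.pow_const 2)
      (C := 1) fun x => ?_)
    rw [abs_of_nonneg (sq_nonneg _)]
    exact (sq_le_one_iff_abs_le_one _).2 (hb x)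

/-- Cauchy–Schwarz applied to `1 = exp(f/2) exp(-f/2)`. -/
theorem sq_measure_univ_le {ρ : Measure E} {f : E → ℝ} (hf : Measurable f) :
    ρ univ ^ 2 ≤ (∫⁻ x, ENNReal.ofReal (Real.exp (f x)) ∂ρ) *
      ∫⁻ x, ENNReal.ofReal (Real.exp (-f x)) ∂ρ := by
  have h := ENNReal.lintegral_mul_le_Lp_mul_Lq ρ (Real.HolderConjugate.two_two)
    (f := fun x => ENNReal.ofReal (Real.exp (f x / 2)))
    (g := fun x => ENNReal.ofReal (Real.exp (-f x / 2)))
    (by fun_prop) (by fun_prop)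
  have h1 : ∀ y : ℝ, ENNReal.ofReal (Real.exp (y / 2)) ^ (2 : ℝ) = ENNReal.ofReal (Real.exp y) := by
    intro y
    rw [ENNReal.ofReal_rpow_of_pos (Real.exp_pos _), ← Real.exp_mul]
    congr 2
    ring
  have h2 : ∀ x, ENNReal.ofReal (Real.exp (f x / 2)) * ENNReal.ofReal (Real.exp (-f x / 2)) = 1 := by
    intro x
    rw [← ENNReal.ofReal_mul (Real.exp_pos _).le, ← Real.exp_add]
    simp [← add_div]
  simp only [Pi.mul_apply, h1, h2, lintegral_const, one_mul] at h
  calc ρ univ ^ 2 ≤ _ ^ 2 := pow_le_pow_left₀ zero_le h 2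
    _ = _ := by
      rw [mul_pow, ← ENNReal.rpow_natCast, ← ENNReal.rpow_natCast, ← ENNReal.rpow_mul,
        ← ENNReal.rpow_mul]
      norm_num

/-- Trades the reciprocal of an integral, whose expectation is hard to reach, for an integral over
`s` to which Fubini applies; the price is `μ(s)⁻²`. -/
theorem inv_lintegral_exp_le {μ : Measure E} [IsFiniteMeasure μ] {s : Set E} (hs : μ s ≠ 0)
    {f : E → ℝ} (hf : Measurable f) :
    (∫⁻ x, ENNReal.ofReal (Real.exp (f x)) ∂μ)⁻¹ ≤
      (μ s ^ 2)⁻¹ * ∫⁻ x in s, ENNReal.ofReal (Real.exp (-f x)) ∂μ := by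
  have h := sq_measure_univ_le (ρ := μ.restrict s) hf
  rw [Measure.restrict_apply_univ] at h
  have h' : μ s ^ 2 ≤ (∫⁻ x, ENNReal.ofReal (Real.exp (f x)) ∂μ) *
      ∫⁻ x in s, ENNReal.ofReal (Real.exp (-f x)) ∂μ :=
    h.trans (mul_le_mul_left (setLIntegral_le_lintegral _ _) _)
  have h0 : μ s ^ 2 ≠ 0 := pow_ne_zero 2 hs
  have htop : μ s ^ 2 ≠ ⊤ := ENNReal.pow_ne_top (measure_ne_top _ _)
  rw [← ENNReal.div_eq_inv_mul, ENNReal.le_div_iff_mul_le (Or.inl h0) (Or.inl htop), mul_comm,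
    ← div_eq_mul_inv]
  exact ENNReal.div_le_of_le_mul' h'

/-- Jensen's inequality for an exponentially tilted probability. -/
theorem exp_mul_integral_tilted_le {μ : Measure E} [IsProbabilityMeasure μ] {f : E → ℝ}
    (hf : Measurable f) {C : ℝ} (hC : ∀ x, |f x| ≤ C) (l b : ℝ) :
    Real.exp (b * ∫ x, f x ∂(μ.tilted fun x => l * f x)) ≤
      (∫ x, Real.exp ((l + b) * f x) ∂μ) / ∫ x, Real.exp (l * f x) ∂μ := by
  have hb : ∀ (c : ℝ) (x : E), |c * f x| ≤ |c| * C := fun c x => by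
    rw [abs_mul]
    exact mul_le_mul_of_nonneg_left (hC x) (abs_nonneg c)
  have hi : Integrable (fun x => Real.exp (l * f x)) μ :=
    integrable_exp_of_abs_le (hf.const_mul l) (hb l)
  have := isProbabilityMeasure_tilted hi
  rw [← integral_const_mul]
  refine (exp_integral_le (integrable_of_abs_le (hf.const_mul b) (hb b))
    (integrable_exp_of_abs_le (hf.const_mul b) (hb b))).trans (le_of_eq ?_)
  rw [integral_tilted, ← integral_div]
  refine integral_congr_ae (Filter.Eventually.of_forall fun x => ?_)
  simp only [smul_eq_mul, add_mul, Real.exp_add]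
  ring

end Moments

/-! ### Concentration of the posterior attached to a bounded family of tests -/

section PosteriorBound

variable {E M : Type*} {n : ℕ} {t : M → M → E → ℝ}

theorem abs_testStat_le (hb : ∀ P Q x, |t P Q x| ≤ 1 / 2) (x : Fin n → E) (P Q : M) :
    |testStat t x P Q| ≤ n := by
  refine (Finset.abs_sum_le_sum_abs _ _).trans ((Finset.sum_le_sum fun i _ => hb P Q (x i)).trans ?_)
  simp only [Finset.sum_const, Finset.card_univ, Fintype.card_fin, nsmul_eq_mul]
  nlinarith [(Nat.cast_nonneg n : (0 : ℝ) ≤ n)]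

theorem abs_mul_testStat_le (hb : ∀ P Q x, |t P Q x| ≤ 1 / 2) (c : ℝ) (x : Fin n → E) (P Q : M) :
    |c * testStat t x P Q| ≤ |c| * n := by
  rw [abs_mul]
  exact mul_le_mul_of_nonneg_left (abs_testStat_le hb x P Q) (abs_nonneg c)

theorem testStat_antisymm (ha : ∀ P Q x, t Q P x = -t P Q x) (x : Fin n → E) (P Q : M) :
    testStat t x Q P = -testStat t x P Q := by
  simp [testStat, ha P Q]

variable [MeasurableSpace M]

theorem meanTestStat_eq_tilted (π : Measure M) (l : ℝ) (x : Fin n → E) (P : M) :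
    meanTestStat t π l x P =
      ∫ Q, testStat t x P Q ∂(π.tilted fun Q => l * testStat t x P Q) := rfl

theorem posterior_eq_tilted (π : Measure M) (β c : ℝ) (x : Fin n → E) :
    posterior t π β c x = π.tilted fun P => -β * meanTestStat t π ((1 + c) * β) x P := rfl

variable [MeasurableSpace E]

theorem measurable_testStat_uncurry (ht : Measurable fun z : M × M × E => t z.1 z.2.1 z.2.2) :
    Measurable fun z : (Fin n → E) × M × M => testStat t z.1 z.2.1 z.2.2 := by
  unfold testStat
  refine Finset.measurable_sum _ fun i _ => ?_
  exact ht.comp (f := fun z : (Fin n → E) × M × M => (z.2.1, z.2.2, z.1 i)) (by fun_prop)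

theorem measurable_testStat (ht : Measurable fun z : M × M × E => t z.1 z.2.1 z.2.2)
    (x : Fin n → E) (P : M) : Measurable fun Q => testStat t x P Q :=
  (measurable_testStat_uncurry ht).comp (f := fun Q : M => (x, P, Q)) (by fun_prop)

variable {π : Measure M} [IsProbabilityMeasure π]

theorem measurable_meanTestStat_uncurry
    (ht : Measurable fun z : M × M × E => t z.1 z.2.1 z.2.2) (l : ℝ) :
    Measurable fun z : (Fin n → E) × M => meanTestStat t π l z.1 z.2 := by
  have hT := measurable_testStat_uncurry (n := n) ht
  have hT' : Measurable fun z : ((Fin n → E) × M) × M => testStat t z.1.1 z.1.2 z.2 :=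
    hT.comp (f := fun z : ((Fin n → E) × M) × M => (z.1.1, z.1.2, z.2)) (by fun_prop)
  have hZ : Measurable fun z : (Fin n → E) × M =>
      ∫ Q, Real.exp (l * testStat t z.1 z.2 Q) ∂π :=
    (StronglyMeasurable.integral_prod_right' (ν := π)
      (f := fun z : ((Fin n → E) × M) × M => Real.exp (l * testStat t z.1.1 z.1.2 z.2))
      (by fun_prop)).measurable
  simp only [meanTestStat_eq_tilted, integral_tilted]
  exact (StronglyMeasurable.integral_prod_right' (ν := π)
      (f := fun z : ((Fin n → E) × M) × M =>
        (Real.exp (l * testStat t z.1.1 z.1.2 z.2) /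
          ∫ Q, Real.exp (l * testStat t z.1.1 z.1.2 Q) ∂π) • testStat t z.1.1 z.1.2 z.2)
      (by
        have := hZ.comp ((measurable_fst : Measurable (Prod.fst : ((Fin n → E) × M) × M → _)))
        simp only [Function.comp_def] at this
        exact Measurable.stronglyMeasurable (by fun_prop))).measurable

theorem measurable_meanTestStat (ht : Measurable fun z : M × M × E => t z.1 z.2.1 z.2.2) (l : ℝ)
    (x : Fin n → E) : Measurable fun P => meanTestStat t π l x P :=
  (measurable_meanTestStat_uncurry ht l).comp (f := fun P : M => (x, P)) (by fun_prop)

theorem abs_meanTestStat_le (ht : Measurable fun z : M × M × E => t z.1 z.2.1 z.2.2)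
    (hb : ∀ P Q x, |t P Q x| ≤ 1 / 2) (l : ℝ) (x : Fin n → E) (P : M) :
    |meanTestStat t π l x P| ≤ n := by
  have := isProbabilityMeasure_tilted (integrable_exp_of_abs_le (μ := π)
    ((measurable_testStat ht x P).const_mul l) (abs_mul_testStat_le hb l x P))
  have h := norm_integral_le_of_norm_le_const (μ := π.tilted fun Q => l * testStat t x P Q)
    (f := fun Q => testStat t x P Q) (C := n)
    (Filter.Eventually.of_forall fun Q => abs_testStat_le hb x P Q)
  simpa [meanTestStat_eq_tilted] using h

theorem integrable_exp_meanTestStat (ht : Measurable fun z : M × M × E => t z.1 z.2.1 z.2.2)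
    (hb : ∀ P Q x, |t P Q x| ≤ 1 / 2) (l c : ℝ) (x : Fin n → E) :
    Integrable (fun P => Real.exp (c * meanTestStat t π l x P)) π := by
  refine integrable_exp_of_abs_le ((measurable_meanTestStat ht l x).const_mul c) (C := |c| * n)
    fun P => ?_
  rw [abs_mul]
  exact mul_le_mul_of_nonneg_left (abs_meanTestStat_le ht hb l x P) (abs_nonneg c)

theorem isProbabilityMeasure_posterior (ht : Measurable fun z : M × M × E => t z.1 z.2.1 z.2.2)
    (hb : ∀ P Q x, |t P Q x| ≤ 1 / 2) (β c : ℝ) (x : Fin n → E) :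
    IsProbabilityMeasure (posterior t π β c x) := by
  rw [posterior_eq_tilted]
  exact isProbabilityMeasure_tilted (integrable_exp_meanTestStat ht hb _ _ x)

theorem posterior_apply (ht : Measurable fun z : M × M × E => t z.1 z.2.1 z.2.2)
    (hb : ∀ P Q x, |t P Q x| ≤ 1 / 2) (β c : ℝ) (x : Fin n → E) {A : Set M}
    (hA : MeasurableSet A) :
    posterior t π β c x A =
      (∫⁻ P in A, ENNReal.ofReal (Real.exp (-β * meanTestStat t π ((1 + c) * β) x P)) ∂π) *
        (∫⁻ P, ENNReal.ofReal (Real.exp (-β * meanTestStat t π ((1 + c) * β) x P)) ∂π)⁻¹ := by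
  have hi := integrable_exp_meanTestStat (π := π) ht hb ((1 + c) * β) (-β) x
  have hm : Measurable fun P =>
      ENNReal.ofReal (Real.exp (-β * meanTestStat t π ((1 + c) * β) x P)) :=
    ((measurable_meanTestStat ht _ x).const_mul _).exp.ennreal_ofReal
  rw [posterior, withDensity_apply _ hA, ← lintegral_mul_const _ hm,
    ← ofReal_integral_eq_lintegral_ofReal hi
      (Filter.Eventually.of_forall fun P => (Real.exp_pos _).le)]
  refine lintegral_congr fun P => ?_
  rw [ENNReal.ofReal_div_of_pos (integral_exp_pos hi), div_eq_mul_inv]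

theorem measurable_posterior_apply (ht : Measurable fun z : M × M × E => t z.1 z.2.1 z.2.2)
    (hb : ∀ P Q x, |t P Q x| ≤ 1 / 2) (β c : ℝ) {A : Set M} (hA : MeasurableSet A) :
    Measurable fun x : Fin n → E => posterior t π β c x A := by
  have hm : Measurable fun z : (Fin n → E) × M =>
      ENNReal.ofReal (Real.exp (-β * meanTestStat t π ((1 + c) * β) z.1 z.2)) :=
    ((measurable_meanTestStat_uncurry ht _).const_mul _).exp.ennreal_ofReal
  simp only [posterior_apply ht hb β c _ hA]
  exact (hm.lintegral_prod_right' (ν := π.restrict A)).mul (hm.lintegral_prod_right' (ν := π)).inv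

/-- Jensen for the tilted prior, then Cauchy–Schwarz on `B` for its normalising constant.
Antisymmetry turns `-T(X, P, Q')` into `T(X, Q', P)`, whose mean carries the useful term `-ℓ(P)/4`.
-/
theorem exp_mul_meanTestStat_le (ht : Measurable fun z : M × M × E => t z.1 z.2.1 z.2.2)
    (hb : ∀ P Q x, |t P Q x| ≤ 1 / 2) (ha : ∀ P Q x, t Q P x = -t P Q x) {B : Set M}
    (hB : π B ≠ 0) (l b : ℝ) (x : Fin n → E) (P : M) :
    ENNReal.ofReal (Real.exp (b * meanTestStat t π l x P)) ≤
      (π B ^ 2)⁻¹ * ∫⁻ z, ENNReal.ofReal (Real.exp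
        ((l + b) * testStat t x P z.1 + l * testStat t x z.2 P)) ∂(π.prod (π.restrict B)) := by
  have hT := measurable_testStat ht x P
  have hi : ∀ c : ℝ, Integrable (fun Q => Real.exp (c * testStat t x P Q)) π := fun c =>
    integrable_exp_of_abs_le (hT.const_mul c) (abs_mul_testStat_le hb c x P)
  have hl : ∀ c : ℝ, ENNReal.ofReal (∫ Q, Real.exp (c * testStat t x P Q) ∂π) =
      ∫⁻ Q, ENNReal.ofReal (Real.exp (c * testStat t x P Q)) ∂π := fun c =>
    ofReal_integral_eq_lintegral_ofReal (hi c)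
      (Filter.Eventually.of_forall fun P => (Real.exp_pos _).le)
  calc ENNReal.ofReal (Real.exp (b * meanTestStat t π l x P))
      ≤ ENNReal.ofReal ((∫ Q, Real.exp ((l + b) * testStat t x P Q) ∂π) /
          ∫ Q, Real.exp (l * testStat t x P Q) ∂π) := by
        rw [meanTestStat_eq_tilted]
        exact ENNReal.ofReal_le_ofReal
          (exp_mul_integral_tilted_le hT (abs_testStat_le hb x P) l b)
    _ = (∫⁻ Q, ENNReal.ofReal (Real.exp ((l + b) * testStat t x P Q)) ∂π) *
          (∫⁻ Q, ENNReal.ofReal (Real.exp (l * testStat t x P Q)) ∂π)⁻¹ := by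
        rw [ENNReal.ofReal_div_of_pos (integral_exp_pos (hi l)), hl, hl, div_eq_mul_inv]
    _ ≤ (∫⁻ Q, ENNReal.ofReal (Real.exp ((l + b) * testStat t x P Q)) ∂π) *
          ((π B ^ 2)⁻¹ *
            ∫⁻ Q in B, ENNReal.ofReal (Real.exp (-(l * testStat t x P Q))) ∂π) := by
        gcongr
        exact inv_lintegral_exp_le hB (hT.const_mul l)
    _ = _ := by
        rw [mul_left_comm, ← lintegral_prod_mul (by fun_prop) (by fun_prop)]
        congr 1
        refine lintegral_congr fun z => ?_
        rw [← ENNReal.ofReal_mul (Real.exp_pos _).le, ← Real.exp_add,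
          testStat_antisymm ha x P z.2, mul_neg]

variable {Ps : Fin n → Measure E} [∀ i, IsProbabilityMeasure (Ps i)] {ℓ : M → ℝ}

theorem integral_add_sq_le {S : Measure E} [IsProbabilityMeasure S]
    (ht : Measurable fun z : M × M × E => t z.1 z.2.1 z.2.2)
    (hb : ∀ P Q x, |t P Q x| ≤ 1 / 2) (hℓ0 : ∀ P, 0 ≤ ℓ P)
    (h1 : ∀ P Q, ∫ x, t P Q x ∂S ≤ 3 * ℓ P - 1 / 4 * ℓ Q)
    (h2 : ∀ P Q, ∫ x, t P Q x ^ 2 ∂S ≤ ℓ P + ℓ Q)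
    {a l : ℝ} (ha0 : 0 ≤ a) (ha1 : a ≤ 1 / 8) (hl0 : 0 ≤ l) (P Q Q' : M) :
    ∫ x, ((a * t P Q x + l * t Q' P x) + (a * t P Q x + l * t Q' P x) ^ 2) ∂S ≤
      (3 * a + 2 * a ^ 2 + 2 * l ^ 2 - l / 4) * ℓ P + (3 * l + 2 * l ^ 2) * ℓ Q' := by
  have hm : ∀ P Q, Measurable (t P Q) := fun P Q =>
    ht.comp (f := fun x : E => (P, Q, x)) (by fun_prop)
  have hi : ∀ P Q, Integrable (t P Q) S := fun P Q => integrable_of_abs_le (hm P Q) (hb P Q)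
  have hi2 : ∀ P Q, Integrable (fun x => t P Q x ^ 2) S := fun P Q =>
    integrable_of_abs_le ((hm P Q).pow_const 2) (C := 1) fun x => by
      rw [abs_of_nonneg (sq_nonneg _)]
      exact (sq_le_one_iff_abs_le_one _).2 ((hb P Q x).trans (by norm_num))
  have hu : ∀ x, |a * t P Q x + l * t Q' P x| ≤ a + l := fun x => by
    refine (abs_add_le _ _).trans ?_
    rw [abs_mul, abs_mul, abs_of_nonneg ha0, abs_of_nonneg hl0]
    nlinarith [hb P Q x, hb Q' P x, abs_nonneg (t P Q x), abs_nonneg (t Q' P x)]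
  have hum : Measurable fun x => a * t P Q x + l * t Q' P x :=
    ((hm P Q).const_mul a).add ((hm Q' P).const_mul l)
  have i0 : Integrable (fun x => a * t P Q x + l * t Q' P x) S :=
    integrable_of_abs_le hum hu
  have i1 : Integrable (fun x => (a * t P Q x + l * t Q' P x) ^ 2) S :=
    integrable_of_abs_le (hum.pow_const 2) (C := (a + l) ^ 2) fun x => by
      rw [abs_pow]
      exact pow_le_pow_left₀ (abs_nonneg _) (hu x) 2
  have i2 : Integrable (fun x => 2 * a ^ 2 * t P Q x ^ 2 + 2 * l ^ 2 * t Q' P x ^ 2) S :=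
    ((hi2 P Q).const_mul _).add ((hi2 Q' P).const_mul _)
  have j1 : Integrable (fun x => a * t P Q x + l * t Q' P x
      + (2 * a ^ 2 * t P Q x ^ 2 + 2 * l ^ 2 * t Q' P x ^ 2)) S :=
    i0.add i2
  have h : ∫ x, ((a * t P Q x + l * t Q' P x) + (a * t P Q x + l * t Q' P x) ^ 2) ∂S ≤
      ∫ x, (a * t P Q x + l * t Q' P x
        + (2 * a ^ 2 * t P Q x ^ 2 + 2 * l ^ 2 * t Q' P x ^ 2)) ∂S := by
    refine integral_mono (i0.add i1) j1 fun x => ?_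
    dsimp only [Pi.add_apply]
    nlinarith [sq_nonneg (a * t P Q x - l * t Q' P x)]
  rw [integral_add i0 i2,
    integral_add ((hi P Q).const_mul a) ((hi Q' P).const_mul l),
    integral_add ((hi2 P Q).const_mul _) ((hi2 Q' P).const_mul _),
    integral_const_mul, integral_const_mul, integral_const_mul, integral_const_mul] at h
  have e1 := mul_le_mul_of_nonneg_left (h1 P Q) ha0
  have e2 := mul_le_mul_of_nonneg_left (h1 Q' P) hl0
  have e3 := mul_le_mul_of_nonneg_left (h2 P Q) (by positivity : 0 ≤ 2 * a ^ 2)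
  have e4 := mul_le_mul_of_nonneg_left (h2 Q' P) (by positivity : 0 ≤ 2 * l ^ 2)
  -- The total coefficient of `ℓ Q` is `-a/4 + 2a²`, nonpositive for `a ≤ 1/8`; hence the bound is
  -- uniform in `Q`, which ranges over the whole prior.
  have e5 : 0 ≤ (1 / 8 - a) * (2 * a) * ℓ Q :=
    mul_nonneg (mul_nonneg (by linarith) (by linarith)) (hℓ0 Q)
  nlinarith

theorem lintegral_exp_mul_meanTestStat_le (hn : 1 ≤ n)
    (ht : Measurable fun z : M × M × E => t z.1 z.2.1 z.2.2)
    (hb : ∀ P Q x, |t P Q x| ≤ 1 / 2) (ha : ∀ P Q x, t Q P x = -t P Q x) (hℓ0 : ∀ P, 0 ≤ ℓ P)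
    (h1 : ∀ P Q, ∫ x, t P Q x ∂(average Ps) ≤ 3 * ℓ P - 1 / 4 * ℓ Q)
    (h2 : ∀ P Q, ∫ x, t P Q x ^ 2 ∂(average Ps) ≤ ℓ P + ℓ Q)
    {B : Set M} (hBm : MeasurableSet B) (hB : π B ≠ 0) {r₀ : ℝ} (hr₀ : ∀ Q ∈ B, ℓ Q ≤ r₀)
    {l b : ℝ} (ha0 : 0 ≤ l + b) (ha1 : l + b ≤ 1 / 8) (hl0 : 0 ≤ l) (hl1 : l ≤ 1 / 8) (P : M) :
    ∫⁻ x : Fin n → E, ENNReal.ofReal (Real.exp (b * meanTestStat t π l x P)) ∂(Measure.pi Ps) ≤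
      (π B ^ 2)⁻¹ * ENNReal.ofReal (Real.exp (n * ((3 * (l + b) + 2 * (l + b) ^ 2 + 2 * l ^ 2
        - l / 4) * ℓ P + (3 * l + 2 * l ^ 2) * r₀))) := by
  have := isProbabilityMeasure_average hn Ps
  have hm : ∀ P Q, Measurable (t P Q) := fun P Q =>
    ht.comp (f := fun x : E => (P, Q, x)) (by fun_prop)
  have hT := measurable_testStat_uncurry (n := n) ht
  have hT1 : Measurable fun z : (Fin n → E) × M × M => testStat t z.1 P z.2.1 :=
    hT.comp (f := fun z : (Fin n → E) × M × M => (z.1, P, z.2.1)) (by fun_prop)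
  have hT2 : Measurable fun z : (Fin n → E) × M × M => testStat t z.1 z.2.2 P :=
    hT.comp (f := fun z : (Fin n → E) × M × M => (z.1, z.2.2, P)) (by fun_prop)
  have hF : Measurable fun z : (Fin n → E) × M × M => ENNReal.ofReal (Real.exp
      ((l + b) * testStat t z.1 P z.2.1 + l * testStat t z.1 z.2.2 P)) := by fun_prop
  refine (lintegral_mono fun x => exp_mul_meanTestStat_le ht hb ha hB l b x P).trans ?_
  rw [lintegral_const_mul _ hF.lintegral_prod_right']
  gcongr
  rw [lintegral_lintegral_swap hF.aemeasurable]
  have hprod : π.prod (π.restrict B) = (π.prod π).restrict (univ ×ˢ B) := by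
    rw [← Measure.prod_restrict, Measure.restrict_univ]
  rw [hprod]
  have hz : ∀ z ∈ (univ : Set M) ×ˢ B, ∫⁻ x : Fin n → E, ENNReal.ofReal (Real.exp
      ((l + b) * testStat t x P z.1 + l * testStat t x z.2 P)) ∂(Measure.pi Ps) ≤
      ENNReal.ofReal (Real.exp (n * ((3 * (l + b) + 2 * (l + b) ^ 2 + 2 * l ^ 2
        - l / 4) * ℓ P + (3 * l + 2 * l ^ 2) * r₀))) := by
    intro z hz
    have hu : ∀ x, |(l + b) * t P z.1 x + l * t z.2 P x| ≤ 1 := fun x => by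
      refine (abs_add_le _ _).trans ?_
      rw [abs_mul, abs_mul, abs_of_nonneg ha0, abs_of_nonneg hl0]
      nlinarith [hb P z.1 x, hb z.2 P x, abs_nonneg (t P z.1 x), abs_nonneg (t z.2 P x)]
    have h := lintegral_exp_sum_le hn Ps
      (u := fun x => (l + b) * t P z.1 x + l * t z.2 P x)
      (((hm P z.1).const_mul (l + b)).add ((hm z.2 P).const_mul l)) hu
    simp only [Finset.sum_add_distrib, ← Finset.mul_sum] at h
    refine h.trans (ENNReal.ofReal_le_ofReal (Real.exp_le_exp.2 ?_))
    refine mul_le_mul_of_nonneg_left ?_ (Nat.cast_nonneg n)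
    refine (integral_add_sq_le ht hb hℓ0 h1 h2 ha0 ha1 hl0 P z.1 z.2).trans ?_
    have := mul_le_mul_of_nonneg_left (hr₀ z.2 hz.2) (by positivity : 0 ≤ 3 * l + 2 * l ^ 2)
    linarith
  refine (setLIntegral_mono' (MeasurableSet.univ.prod hBm) hz).trans ?_
  rw [setLIntegral_const]
  exact mul_le_of_le_one_right' prob_le_one

/-- If `D⁻¹ ≤ s` the first term dominates. Otherwise `N/D ≤ 1 ≤ s⁻¹ D⁻¹`. This separates numerator
and denominator, so that only their separate expectations are needed. -/
theorem mul_inv_le_add {N D s : ℝ≥0∞} (hND : N ≤ D) (hs0 : s ≠ 0) (hs : s ≠ ⊤) :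
    N * D⁻¹ ≤ s * N + s⁻¹ * D⁻¹ := by
  rcases le_total s D⁻¹ with h | h
  · have h1 : N * D⁻¹ ≤ 1 := ENNReal.mul_inv_le_one D |>.trans' (by gcongr)
    calc N * D⁻¹ ≤ s⁻¹ * s := by rwa [ENNReal.inv_mul_cancel hs0 hs]
      _ ≤ s⁻¹ * D⁻¹ := by gcongr
      _ ≤ _ := le_add_self
  · calc N * D⁻¹ ≤ N * s := by gcongr
      _ = s * N := mul_comm _ _
      _ ≤ _ := le_self_add

/-- Concentration of the posterior outside a ball for the loss `ℓ`, in terms of the prior mass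
`exp (-b)` of a set on which the loss is at most `r₀`. -/
theorem lintegral_posterior_le (hn : 1 ≤ n)
    (ht : Measurable fun z : M × M × E => t z.1 z.2.1 z.2.2)
    (hb : ∀ P Q x, |t P Q x| ≤ 1 / 2) (ha : ∀ P Q x, t Q P x = -t P Q x) (hℓ0 : ∀ P, 0 ≤ ℓ P)
    (h1 : ∀ P Q, ∫ x, t P Q x ∂(average Ps) ≤ 3 * ℓ P - 1 / 4 * ℓ Q)
    (h2 : ∀ P Q, ∫ x, t P Q x ^ 2 ∂(average Ps) ≤ ℓ P + ℓ Q)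
    {A B : Set M} (hAm : MeasurableSet A) (hBm : MeasurableSet B)
    {ρ r₀ b ξ : ℝ} (hA : ∀ P ∈ A, ρ ≤ ℓ P) (hr₀ : ∀ Q ∈ B, ℓ Q ≤ r₀) (hr : 0 ≤ r₀)
    (hB : ENNReal.ofReal (Real.exp (-b)) ≤ π B)
    (hρ : 6 * b + n / 500 * (14 * r₀ - ρ / 5) ≤ -(2 * ξ)) :
    ∫⁻ x : Fin n → E, posterior t π (1 / 500) (1 / 125) x A ∂(Measure.pi Ps) ≤
      ENNReal.ofReal (2 * Real.exp (-ξ)) := by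
  have hB0 : π B ≠ 0 := fun h => by
    rw [h] at hB
    exact (ENNReal.ofReal_pos.2 (Real.exp_pos (-b))).not_ge hB
  have hB2 : (π B ^ 2)⁻¹ ≤ ENNReal.ofReal (Real.exp (2 * b)) := by
    rw [ENNReal.inv_le_iff_inv_le, ← ENNReal.ofReal_inv_of_pos (Real.exp_pos _), ← Real.exp_neg]
    refine le_trans (le_of_eq ?_) (pow_le_pow_left₀ zero_le hB 2)
    rw [← ENNReal.ofReal_pow (Real.exp_pos _).le, ← Real.exp_nat_mul]
    congr 2
    push_cast
    ring
  set l : ℝ := (1 + 1 / 125) * (1 / 500) with hl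
  set g : ℝ → (Fin n → E) → M → ℝ≥0∞ := fun c x P =>
    ENNReal.ofReal (Real.exp (c * meanTestStat t π l x P)) with hg
  have hgm : ∀ c, Measurable fun z : (Fin n → E) × M => g c z.1 z.2 := fun c =>
    ((measurable_meanTestStat_uncurry ht _).const_mul c).exp.ennreal_ofReal
  have hn0 : (0 : ℝ) ≤ n := Nat.cast_nonneg n
  -- the numerator
  have hN : ∫⁻ x : Fin n → E, ∫⁻ P in A, g (-(1 / 500)) x P ∂π ∂(Measure.pi Ps) ≤
      ENNReal.ofReal (Real.exp (2 * b + n / 500 * (4 * r₀ - ρ / 5))) := by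
    rw [lintegral_lintegral_swap (hgm _).aemeasurable]
    have hP : ∀ P ∈ A, ∫⁻ x : Fin n → E, g (-(1 / 500)) x P ∂(Measure.pi Ps) ≤
        ENNReal.ofReal (Real.exp (2 * b + n / 500 * (4 * r₀ - ρ / 5))) := by
      intro P hP
      refine (lintegral_exp_mul_meanTestStat_le hn ht hb ha hℓ0 h1 h2 hBm hB0 hr₀
        (by norm_num [hl]) (by norm_num [hl]) (by norm_num [hl]) (by norm_num [hl]) P).trans ?_
      refine (mul_le_mul_left hB2 _).trans ?_
      rw [← ENNReal.ofReal_mul (Real.exp_pos _).le, ← Real.exp_add]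
      refine ENNReal.ofReal_le_ofReal (Real.exp_le_exp.2 (add_le_add_right ?_ _))
      rw [show n / 500 * (4 * r₀ - ρ / 5) = n * ((4 * r₀ - ρ / 5) / 500) by ring]
      refine mul_le_mul_of_nonneg_left ?_ hn0
      have := hA P hP
      have := hℓ0 P
      -- With `β = 1/500` and `c = 1/125`, the coefficient of `ℓ P` is about `-0.224 β`, below
      -- `-β/5`, and that of `r₀` about `3.03 β`, below `4β`.
      rw [hl]
      norm_num
      linarith
    refine (setLIntegral_mono' hAm hP).trans ?_
    rw [setLIntegral_const]
    exact mul_le_of_le_one_right' prob_le_one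
  -- the denominator
  have hD : ∫⁻ x : Fin n → E, (∫⁻ P, g (-(1 / 500)) x P ∂π)⁻¹ ∂(Measure.pi Ps) ≤
      ENNReal.ofReal (Real.exp (4 * b + n / 500 * (10 * r₀))) := by
    have hx : ∀ x : Fin n → E, (∫⁻ P, g (-(1 / 500)) x P ∂π)⁻¹ ≤
        (π B ^ 2)⁻¹ * ∫⁻ P in B, g (1 / 500) x P ∂π := fun x => by
      have h := inv_lintegral_exp_le hB0 ((measurable_meanTestStat (π := π) ht l x).const_mul
        (-(1 / 500)))
      simp only [← neg_mul, neg_neg] at h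
      exact h
    refine (lintegral_mono hx).trans ?_
    rw [lintegral_const_mul _ (hgm _).lintegral_prod_right',
      lintegral_lintegral_swap (hgm _).aemeasurable]
    have hP : ∀ P ∈ B, ∫⁻ x : Fin n → E, g (1 / 500) x P ∂(Measure.pi Ps) ≤
        ENNReal.ofReal (Real.exp (2 * b + n / 500 * (10 * r₀))) := by
      intro P hP
      refine (lintegral_exp_mul_meanTestStat_le hn ht hb ha hℓ0 h1 h2 hBm hB0 hr₀
        (by norm_num [hl]) (by norm_num [hl]) (by norm_num [hl]) (by norm_num [hl]) P).trans ?_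
      refine (mul_le_mul_left hB2 _).trans ?_
      rw [← ENNReal.ofReal_mul (Real.exp_pos _).le, ← Real.exp_add]
      refine ENNReal.ofReal_le_ofReal (Real.exp_le_exp.2 (add_le_add_right ?_ _))
      rw [show n / 500 * (10 * r₀) = n * ((10 * r₀) / 500) by ring]
      refine mul_le_mul_of_nonneg_left ?_ hn0
      have := hr₀ P hP
      have := hℓ0 P
      -- Here `l + b = (2 + c)β`: the coefficients of `ℓ P` and `r₀` are about `5.8 β` and `3.03 β`,
      -- and `ℓ P ≤ r₀` on `B`, so `10 β r₀` is enough.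
      rw [hl]
      norm_num
      linarith
    have hP' : ∫⁻ P in B, ∫⁻ x : Fin n → E, g (1 / 500) x P ∂(Measure.pi Ps) ∂π ≤
        ENNReal.ofReal (Real.exp (2 * b + n / 500 * (10 * r₀))) := by
      refine (setLIntegral_mono' hBm hP).trans ?_
      rw [setLIntegral_const]
      exact mul_le_of_le_one_right' prob_le_one
    refine (mul_le_mul' hB2 hP').trans (le_of_eq ?_)
    rw [← ENNReal.ofReal_mul (Real.exp_pos _).le, ← Real.exp_add]
    congr 2
    ring
  -- Chosen so that the denominator term is exactly `exp(-ξ)`; the hypothesis `hρ` then says that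
  -- the numerator term is at most `exp(-ξ)` too.
  set s : ℝ := 4 * b + n / 500 * (10 * r₀) + ξ with hs
  have hs0 : ENNReal.ofReal (Real.exp s) ≠ 0 := (ENNReal.ofReal_pos.2 (Real.exp_pos _)).ne'
  have hx : ∀ x : Fin n → E, posterior t π (1 / 500) (1 / 125) x A ≤
      ENNReal.ofReal (Real.exp s) * (∫⁻ P in A, g (-(1 / 500)) x P ∂π) +
        (ENNReal.ofReal (Real.exp s))⁻¹ * (∫⁻ P, g (-(1 / 500)) x P ∂π)⁻¹ := fun x => by
    rw [posterior_apply ht hb _ _ x hAm]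
    exact mul_inv_le_add (setLIntegral_le_lintegral _ _) hs0 ENNReal.ofReal_ne_top
  have hinv : Measurable fun x : Fin n → E => (∫⁻ P, g (-(1 / 500)) x P ∂π)⁻¹ :=
    (hgm _).lintegral_prod_right'.inv
  refine (lintegral_mono hx).trans ?_
  rw [lintegral_add_left ((hgm _).lintegral_prod_right'.const_mul _),
    lintegral_const_mul _ (hgm _).lintegral_prod_right',
    lintegral_const_mul _ hinv, two_mul,
    ENNReal.ofReal_add (Real.exp_pos _).le (Real.exp_pos _).le]
  refine add_le_add ((mul_le_mul_right hN _).trans ?_) ((mul_le_mul_right hD _).trans ?_)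
  · rw [← ENNReal.ofReal_mul (Real.exp_pos _).le, ← Real.exp_add]
    refine ENNReal.ofReal_le_ofReal (Real.exp_le_exp.2 ?_)
    rw [hs]
    linarith
  · rw [← ENNReal.ofReal_inv_of_pos (Real.exp_pos _), ← Real.exp_neg,
      ← ENNReal.ofReal_mul (Real.exp_pos _).le, ← Real.exp_add]
    refine ENNReal.ofReal_le_ofReal (Real.exp_le_exp.2 ?_)
    rw [hs]
    linarith

end PosteriorBound

/-! ### Measurable selection from the fibres of a continuous map on a compact set -/

/-- The Cantor set is a compact subset of the line, so each nonempty fibre, being closed, has a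
least point. Choosing it is measurable because its sublevel sets on the range are images of compact
sets, hence closed. -/
theorem exists_measurable_section_cantorSet {Y : Type*} [TopologicalSpace Y] [T2Space Y]
    [MeasurableSpace Y] [BorelSpace Y] {G : cantorSet → Y} (hG : Continuous G) :
    ∃ c : Y → cantorSet, Measurable c ∧ ∀ y ∈ range G, G (c y) = y := by
  have : CompactSpace cantorSet := isCompact_iff_compactSpace.1 isCompact_cantorSet
  let d : cantorSet := ⟨0, zero_mem_cantorSet⟩
  have hex : ∀ y, ∃ c : cantorSet,
      (y ∈ range G → G c = y ∧ ∀ z, G z = y → (c : ℝ) ≤ z) ∧ (y ∉ range G → c = d) := by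
    intro y
    by_cases hy : y ∈ range G
    · obtain ⟨z, hz⟩ := hy
      obtain ⟨c, hc, hmin⟩ := ((isClosed_singleton (x := y)).preimage hG).isCompact.exists_isMinOn
        ⟨z, hz⟩ continuous_subtype_val.continuousOn
      exact ⟨c, fun _ => ⟨hc, fun z hz => hmin hz⟩, fun h => absurd ⟨z, hz⟩ h⟩
    · exact ⟨d, fun h => absurd h hy, fun _ => rfl⟩
  choose c hc hd using hex
  refine ⟨c, Measurable.subtype_mk (f := fun y => (c y : ℝ)) (measurable_of_Iic fun a => ?_),
    fun y hy => (hc y hy).1⟩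
  have hcl : ∀ s : Set cantorSet, IsClosed s → MeasurableSet (G '' s) := fun s hs =>
    (hs.isCompact.image hG).isClosed.measurableSet
  have himg : MeasurableSet (G '' {z | (z : ℝ) ≤ a}) :=
    hcl _ (isClosed_le continuous_subtype_val continuous_const)
  have hrange : MeasurableSet (range G) := image_univ (f := G) ▸ hcl univ isClosed_univ
  have heq : (fun y => (c y : ℝ)) ⁻¹' Iic a =
      G '' {z | (z : ℝ) ≤ a} ∪ (range G)ᶜ ∩ {_y | (d : ℝ) ≤ a} := by
    ext y
    simp only [mem_preimage, mem_Iic, mem_union, mem_image, mem_ofPred_eq, mem_inter_iff,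
      mem_compl_iff]
    by_cases hy : y ∈ range G
    · refine ⟨fun h => Or.inl ⟨c y, h, (hc y hy).1⟩, ?_⟩
      rintro (⟨z, hz, hzy⟩ | h)
      · exact ((hc y hy).2 z hzy).trans hz
      · exact absurd hy h.1
    · rw [hd y hy]
      refine ⟨fun h => Or.inr ⟨hy, h⟩, ?_⟩
      rintro (⟨z, hz, hzy⟩ | h)
      · exact absurd ⟨z, hzy⟩ hy
      · exact h.2
  rw [heq]
  exact himg.union (hrange.compl.inter (MeasurableSet.const _))

/-- Every nonempty compact metric space is a continuous image of the Cantor set, which reduces the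
question to the previous case. -/
theorem exists_measurable_section {X Y : Type*} [MetricSpace X] [MeasurableSpace X] [BorelSpace X]
    [TopologicalSpace Y] [T2Space Y] [MeasurableSpace Y] [BorelSpace Y] {K : Set X}
    (hK : IsCompact K) (hne : K.Nonempty) {f : X → Y} (hf : ContinuousOn f K) :
    ∃ σ : Y → X, Measurable σ ∧ (∀ y, σ y ∈ K) ∧ ∀ y ∈ f '' K, f (σ y) = y := by
  have : CompactSpace K := isCompact_iff_compactSpace.1 hK
  have : Nonempty K := hne.to_subtype
  obtain ⟨φ, hφ, hsurj⟩ := exists_nat_bool_continuous_surjective_of_compact K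
  have hg : Continuous fun c => φ (cantorSetHomeomorphNatToBool c) :=
    hφ.comp cantorSetHomeomorphNatToBool.continuous
  obtain ⟨c, hcm, hc⟩ := exists_measurable_section_cantorSet
    (hf.comp_continuous (continuous_subtype_val.comp hg) fun c => Subtype.coe_prop _)
  refine ⟨fun y => φ (cantorSetHomeomorphNatToBool (c y)),
    (continuous_subtype_val.comp hg).measurable.comp hcm, fun y => Subtype.coe_prop _, ?_⟩
  rintro _ ⟨x, hx, rfl⟩
  refine hc _ ?_
  obtain ⟨b, hb⟩ := hsurj ⟨x, hx⟩
  obtain ⟨z, rfl⟩ := cantorSetHomeomorphNatToBool.surjective b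
  exact ⟨z, by simp [hb]⟩

/-! ### The topology of the model -/

theorem abs_measureReal_sub_le {E : Type*} [MeasurableSpace E] (P Q : Measure E)
    [IsProbabilityMeasure P] [IsProbabilityMeasure Q] {A : Set E} (hA : MeasurableSet A) {ε : ℝ}
    (hε : 0 < ε) : |P.real A - Q.real A| ≤ sqHellinger P Q / ε + 2 * ε := by
  obtain ⟨a, ha, ha'⟩ := exists_density (P + Q) (P := P)
    (Measure.absolutelyContinuous_of_le (Measure.le_add_right le_rfl))
  obtain ⟨b, hb, hb'⟩ := exists_density (P + Q) (P := Q)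
    (Measure.absolutelyContinuous_of_le (Measure.le_add_left le_rfl))
  obtain ⟨ν, hν, hPν⟩ : ∃ ν : Measure E, SigmaFinite ν ∧ ν = P + Q := ⟨P + Q, inferInstance, rfl⟩
  rw [← hPν] at ha' hb'
  have ia := lintegral_density_ne_top ha'
  have ib := lintegral_density_ne_top hb'
  have Ja := integrable_toReal_of_lintegral_ne_top ha.aemeasurable ia
  have Jb := integrable_toReal_of_lintegral_ne_top hb.aemeasurable ib
  have hreal : ∀ {R : Measure E} {c : E → ℝ≥0∞}, Measurable c → R = ν.withDensity c →
      ∫⁻ x, c x ∂ν ≠ ⊤ → ∀ {s : Set E}, MeasurableSet s →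
        R.real s = ∫ x in s, (c x).toReal ∂ν := by
    intro R c hc hR hi s hs
    rw [integral_toReal hc.aemeasurable (ae_restrict_of_ae (ae_lt_top hc hi)), measureReal_def, hR,
      withDensity_apply _ hs]
  have ha1 : ∫ x, (a x).toReal ∂ν = 1 := by
    rw [← setIntegral_univ, ← hreal ha ha' ia MeasurableSet.univ, probReal_univ]
  have hb1 : ∫ x, (b x).toReal ∂ν = 1 := by
    rw [← setIntegral_univ, ← hreal hb hb' ib MeasurableSet.univ, probReal_univ]
  have I := integrable_sq_sub_sqrt ha hb ia ib
  rw [hreal ha ha' ia hA, hreal hb hb' ib hA, ← integral_sub Ja.integrableOn Jb.integrableOn,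
    sqHellinger_eq ha hb ha' hb']
  refine (abs_integral_le_integral_abs).trans ?_
  refine (setIntegral_le_integral (Ja.sub Jb).abs
    (Filter.Eventually.of_forall fun x => abs_nonneg _)).trans ?_
  have Jab : Integrable (fun x => (a x).toReal + (b x).toReal) ν := Ja.add Jb
  have hJ : Integrable (fun x => (√(a x).toReal - √(b x).toReal) ^ 2 * (1 / (2 * ε)) +
      ε * ((a x).toReal + (b x).toReal)) ν := (I.mul_const _).add (Jab.const_mul ε)
  -- With `u = √a`, `v = √b`: `|u² - v²| = |u - v|(u + v) ≤ (u - v)²/(2ε) + ε(u + v)²/2`, and `(u +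
  -- v)² ≤ 2(u² + v²)`.
  have h := integral_mono (Ja.sub Jb).abs hJ fun x => by
    have h1 := Real.sq_sqrt (ENNReal.toReal_nonneg (a := a x))
    have h2 := Real.sq_sqrt (ENNReal.toReal_nonneg (a := b x))
    have h3 := Real.sqrt_nonneg (a x).toReal
    have h4 := Real.sqrt_nonneg (b x).toReal
    generalize √(a x).toReal = u at *
    generalize √(b x).toReal = v at *
    simp only [Pi.sub_apply]
    rw [← h1, ← h2, sq_sub_sq, abs_mul, abs_of_nonneg (add_nonneg h3 h4), mul_one_div,
      div_add' _ _ _ (by positivity), le_div_iff₀ (by positivity), ← sq_abs (u - v)]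
    nlinarith [sq_nonneg (|u - v| - ε * (u + v)), mul_nonneg hε.le (sq_nonneg (u - v)),
      sq_nonneg (ε * (u - v))]
  rw [integral_add (I.mul_const _) (Jab.const_mul ε), integral_mul_const,
    integral_const_mul, integral_add Ja Jb, ha1, hb1] at h
  refine h.trans (le_of_eq ?_)
  field_simp
  ring

section Model

variable {E : Type*} [MeasurableSpace E] {k : ℕ} {μ : Measure E} {p : (Fin k → ℝ) → E → ℝ≥0}

instance : BorelSpace (Model μ p) := ⟨rfl⟩

theorem isOpen_model_iff {U : Set (Model μ p)} : IsOpen U ↔ ∀ P ∈ U, ∃ ε : ℝ, 0 < ε ∧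
    ∀ Q : Model μ p, hellinger P.toMeasure Q.toMeasure < ε → Q ∈ U := Iff.rfl

theorem isProbabilityMeasure_toMeasure (hp : ∀ θ, IsProbabilityMeasure (law μ p θ))
    (P : Model μ p) : IsProbabilityMeasure P.toMeasure := by
  obtain ⟨_, θ, rfl⟩ := P
  exact hp θ

theorem continuous_measureReal (hp : ∀ θ, IsProbabilityMeasure (law μ p θ)) {A : Set E}
    (hA : MeasurableSet A) : Continuous fun P : Model μ p => P.toMeasure.real A := by
  refine continuous_def.2 fun V hV => isOpen_model_iff.2 fun P hP => ?_
  obtain ⟨δ, hδ, hball⟩ := Metric.isOpen_iff.1 hV _ hP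
  refine ⟨δ / 4, by positivity, fun Q hQ => hball ?_⟩
  have := isProbabilityMeasure_toMeasure hp P
  have := isProbabilityMeasure_toMeasure hp Q
  have h := abs_measureReal_sub_le P.toMeasure Q.toMeasure hA (ε := δ / 4) (by positivity)
  have h2 : sqHellinger P.toMeasure Q.toMeasure / (δ / 4) ≤ δ / 4 := by
    rw [div_le_iff₀ (by positivity), ← hellinger_sq, ← sq]
    exact pow_le_pow_left₀ (Real.sqrt_nonneg _) hQ.le 2
  rw [Metric.mem_ball, dist_comm, Real.dist_eq]
  linarith

/-- Distinct measures differ on some measurable `A`, and `P ↦ P(A)` is Hellinger-continuous.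
Separation is what makes compact images closed, hence Borel. -/
theorem t2Space_model (hp : ∀ θ, IsProbabilityMeasure (law μ p θ)) : T2Space (Model μ p) := by
  refine ⟨fun P Q hPQ => ?_⟩
  have := isProbabilityMeasure_toMeasure hp P
  have := isProbabilityMeasure_toMeasure hp Q
  obtain ⟨A, hA, hne⟩ : ∃ A, MeasurableSet A ∧ P.toMeasure.real A ≠ Q.toMeasure.real A := by
    by_contra! h
    refine hPQ (Subtype.ext (Measure.ext fun A hA => ?_))
    exact (measureReal_eq_measureReal_iff (μ := P.toMeasure) (ν := Q.toMeasure)).1 (h A hA)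
  exact separated_by_continuous (continuous_measureReal hp hA) hne

theorem continuousOn_point {R α B : ℝ} (hα : 0 < α)
    (hH : ∀ θ θ' : Fin k → ℝ, ‖θ‖ ≤ R → ‖θ'‖ ≤ R →
      hellinger (law μ p θ) (law μ p θ') ≤ √B * ‖θ - θ'‖ ^ α) :
    ContinuousOn (Model.point μ p) (Metric.closedBall 0 R) := by
  rw [continuousOn_iff]
  intro θ hθ V hV hθV
  obtain ⟨ε, hε, hball⟩ := isOpen_model_iff.1 hV _ hθV
  have hcont : Continuous fun θ' : Fin k → ℝ => √B * ‖θ - θ'‖ ^ α :=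
    continuous_const.mul ((continuous_const.sub continuous_id).norm.rpow_const
      fun _ => Or.inr hα.le)
  refine ⟨{θ' | √B * ‖θ - θ'‖ ^ α < ε}, isOpen_lt hcont continuous_const, ?_, ?_⟩
  · simpa [Real.zero_rpow hα.ne'] using hε
  · rintro θ' ⟨h1, h2⟩
    exact hball _ ((hH θ θ' (mem_closedBall_zero_iff.1 hθ) (mem_closedBall_zero_iff.1 h2)).trans_lt
      h1)

theorem measurable_sqHellinger_law [SigmaFinite μ]
    (hpm : Measurable fun z : E × (Fin k → ℝ) => p z.2 z.1)
    (hp : ∀ θ, IsProbabilityMeasure (law μ p θ)) (S : Measure E) [IsFiniteMeasure S] :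
    Measurable fun θ => sqHellinger S (law μ p θ) := by
  obtain ⟨ν, s, f, hν, hs, hf, hS, hsfin, hd⟩ := exists_common_density S μ
  have hpθ : ∀ θ, Measurable (p θ) := fun θ =>
    hpm.comp (f := fun x : E => (x, θ)) (by fun_prop)
  have heq : ∀ θ, sqHellinger S (law μ p θ) =
      1 / 2 * ∫ x, (√(s x).toReal - √(f x * p θ x).toReal) ^ 2 ∂ν := fun θ => by
    have := hp θ
    exact sqHellinger_eq hs (hf.mul (hpθ θ).coe_nnreal_ennreal) hS (hd _ (hpθ θ))
  simp only [heq]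
  have hpm' : Measurable fun z : (Fin k → ℝ) × E => p z.1 z.2 :=
    hpm.comp (f := fun z : (Fin k → ℝ) × E => (z.2, z.1)) (by fun_prop)
  refine (StronglyMeasurable.measurable (StronglyMeasurable.integral_prod_right' (ν := ν)
    (f := fun z : (Fin k → ℝ) × E => (√(s z.2).toReal - √(f z.2 * p z.1 z.2).toReal) ^ 2)
    (Measurable.stronglyMeasurable ?_))).const_mul _
  have h1 : Measurable fun z : (Fin k → ℝ) × E => f z.2 * (p z.1 z.2 : ℝ≥0∞) :=
    (hf.comp measurable_snd).mul hpm'.coe_nnreal_ennreal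
  fun_prop

end Model

/-! ### The sparsity prior -/

section Prior

variable {k : ℕ}

theorem measurable_extendZero (m : Finset (Fin k)) : Measurable (extendZero m) := by
  refine measurable_pi_lambda _ fun i => ?_
  unfold extendZero
  by_cases h : i ∈ m
  · simp only [h, dite_true]
    fun_prop
  · simp only [h, dite_false]
    fun_prop

theorem volume_cube (m : Finset (Fin k)) (R : ℝ) :
    volume (Icc (fun _ => -R) (fun _ => R) : Set (m → ℝ)) = ENNReal.ofReal (2 * R) ^ m.card := by
  rw [Real.volume_Icc_pi]
  simp [two_mul]

theorem isProbabilityMeasure_cond_cube (m : Finset (Fin k)) {R : ℝ} (hR : 0 < R) :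
    IsProbabilityMeasure (ProbabilityTheory.cond (volume : Measure (m → ℝ))
      (Icc (fun _ => -R) (fun _ => R))) := by
  refine ProbabilityTheory.cond_isProbabilityMeasure_of_finite ?_ ?_
  · rw [volume_cube]
    exact pow_ne_zero _ (ENNReal.ofReal_pos.2 (by linarith)).ne'
  · rw [volume_cube]
    exact ENNReal.pow_ne_top ENNReal.ofReal_ne_top

theorem isProbabilityMeasure_uniformCube (m : Finset (Fin k)) {R : ℝ} (hR : 0 < R) :
    IsProbabilityMeasure (uniformCube m R) := by
  have := isProbabilityMeasure_cond_cube m hR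
  exact Measure.isProbabilityMeasure_map (measurable_extendZero m).aemeasurable

theorem norm_extendZero_le {m : Finset (Fin k)} {R : ℝ} (hR : 0 ≤ R) {u : m → ℝ}
    (hu : u ∈ Icc (fun _ => -R) (fun _ => R)) : ‖extendZero m u‖ ≤ R := by
  refine (pi_norm_le_iff_of_nonneg hR).2 fun i => ?_
  unfold extendZero
  split_ifs with h
  · exact abs_le.2 ⟨hu.1 ⟨i, h⟩, hu.2 ⟨i, h⟩⟩
  · simpa using hR

theorem ae_uniformCube_mem (m : Finset (Fin k)) {R : ℝ} (hR : 0 ≤ R) :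
    ∀ᵐ θ ∂(uniformCube m R), θ ∈ Metric.closedBall (0 : Fin k → ℝ) R := by
  refine (ae_map_iff (p := fun θ => θ ∈ Metric.closedBall (0 : Fin k → ℝ) R)
    (measurable_extendZero m).aemeasurable Metric.isClosed_closedBall.measurableSet).2 ?_
  filter_upwards [ProbabilityTheory.ae_cond_mem (μ := (volume : Measure (m → ℝ)))
    (s := Icc (fun _ => -R) (fun _ => R)) measurableSet_Icc] with u hu
  exact mem_closedBall_zero_iff.2 (norm_extendZero_le hR hu)

theorem le_uniformCube {m : Finset (Fin k)} {R δ : ℝ} (hδ : 0 < δ) (hδR : δ ≤ R)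
    {θ : Fin k → ℝ} (hθ : θ ∈ thetaCube m R) :
    ENNReal.ofReal (δ / (2 * R)) ^ m.card ≤
      uniformCube m R {θ' | ‖θ'‖ ≤ R ∧ ‖θ - θ'‖ ≤ δ} := by
  have hR : 0 < R := hδ.trans_le hδR
  have hθR : ∀ i, |θ i| ≤ R := fun i => (norm_le_pi_norm θ i).trans hθ.2
  refine le_trans ?_ (Measure.le_map_apply (measurable_extendZero m).aemeasurable _)
  rw [ProbabilityTheory.cond_apply measurableSet_Icc, volume_cube]
  -- Near the boundary the `δ`-cube is cut by `[-R, R]`, but each side keeps length at least `δ`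
  -- since `|θ i| ≤ R` and `δ ≤ R`; hence the ratio `δ/(2R)` per coordinate.
  have hsub : (Icc (fun i => max (-R) (θ i - δ)) (fun i => min R (θ i + δ)) : Set (m → ℝ)) ⊆
      Icc (fun _ => -R) (fun _ => R) ∩
        extendZero m ⁻¹' {θ' | ‖θ'‖ ≤ R ∧ ‖θ - θ'‖ ≤ δ} := by
    intro u hu
    have h1 : u ∈ (Icc (fun _ => -R) (fun _ => R) : Set (m → ℝ)) :=
      ⟨fun i => (le_max_left _ _).trans (hu.1 i), fun i => (hu.2 i).trans (min_le_left _ _)⟩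
    refine ⟨h1, norm_extendZero_le hR.le h1, (pi_norm_le_iff_of_nonneg hδ.le).2 fun i => ?_⟩
    rw [Pi.sub_apply, Real.norm_eq_abs, extendZero]
    split_ifs with h
    · have h2 : θ i - δ ≤ u ⟨i, h⟩ := (le_max_right _ _).trans (hu.1 ⟨i, h⟩)
      have h3 : u ⟨i, h⟩ ≤ θ i + δ := (hu.2 ⟨i, h⟩).trans (min_le_right _ _)
      rw [abs_le]
      constructor <;> linarith
    · rw [hθ.1 i h]
      simpa using hδ.le
  refine le_trans ?_ (mul_le_mul_right (measure_mono hsub) _)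
  rw [Real.volume_Icc_pi]
  have hprod : ENNReal.ofReal δ ^ m.card ≤
      ∏ i : m, ENNReal.ofReal (min R (θ i + δ) - max (-R) (θ i - δ)) := by
    calc ENNReal.ofReal δ ^ m.card = ∏ _i : m, ENNReal.ofReal δ := by simp
      _ ≤ _ := Finset.prod_le_prod' fun i _ => ENNReal.ofReal_le_ofReal (by
        have := abs_le.1 (hθR i)
        rcases min_choice R (θ i + δ) with h | h <;> rcases max_choice (-R) (θ i - δ) with h' | h' <;>
          rw [h, h'] <;> linarith)
  refine le_trans (le_of_eq ?_) (mul_le_mul_right hprod _)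
  rw [ENNReal.inv_pow, ← mul_pow, ENNReal.ofReal_div_of_pos (by linarith), div_eq_mul_inv,
    mul_comm (ENNReal.ofReal δ)]

theorem sum_exp_neg_penalty (hk : 1 ≤ k) :
    ∑ m : Finset (Fin k), Real.exp (-penalty m) = 1 := by
  have hk0 : (0 : ℝ) < k := by exact_mod_cast hk
  have hpos : (0 : ℝ) < 1 + 1 / k := by positivity
  have h : ∀ m : Finset (Fin k), Real.exp (-penalty m) =
      ((1 / k : ℝ) ^ m.card * 1 ^ (Fintype.card (Fin k) - m.card)) * ((1 + 1 / k : ℝ) ^ k)⁻¹ := by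
    intro m
    rw [penalty, neg_add, Real.exp_add, ← mul_neg, ← Real.log_inv, Real.exp_nat_mul,
      Real.exp_log (by positivity), Real.exp_neg, Real.exp_nat_mul, Real.exp_log hpos, one_pow,
      mul_one, one_div]
  simp only [h]
  -- Binomial formula over subsets: `∑ k^(-|m|) = (1 + 1/k)^k`, which the second part of the penalty
  -- normalises.
  rw [← Finset.sum_mul, Fintype.sum_pow_mul_eq_add_pow, Fintype.card_fin, add_comm (1 / k : ℝ) 1]
  exact mul_inv_cancel₀ (pow_ne_zero _ hpos.ne')

theorem penalty_le (hk : 1 ≤ k) (m : Finset (Fin k)) :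
    penalty m ≤ m.card * Real.log k + 1 := by
  have hk0 : (0 : ℝ) < k := by exact_mod_cast hk
  have h := Real.log_le_sub_one_of_pos (by positivity : (0 : ℝ) < 1 + 1 / k)
  have h2 := mul_le_mul_of_nonneg_left h hk0.le
  have h3 : (k : ℝ) * (1 + 1 / k - 1) = 1 := by field_simp; ring
  rw [penalty]
  linarith

variable {E : Type*} [MeasurableSpace E] {μ : Measure E} {p : (Fin k → ℝ) → E → ℝ≥0} {R : ℝ}

/-- Continuity is known on the ball only, but `ν_m` lives there. Without a.e. measurability the
image measure in the prior would be zero by convention. -/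
theorem aemeasurable_point (hR : 0 ≤ R)
    (hc : ContinuousOn (Model.point μ p) (Metric.closedBall 0 R)) (m : Finset (Fin k)) :
    AEMeasurable (Model.point μ p) (uniformCube m R) := by
  classical
  refine ⟨(Metric.closedBall (0 : Fin k → ℝ) R).piecewise (Model.point μ p)
    fun _ => Model.point μ p 0, ?_, ?_⟩
  · exact hc.measurable_piecewise continuousOn_const Metric.isClosed_closedBall.measurableSet
  · filter_upwards [ae_uniformCube_mem m hR] with θ hθ
    rw [piecewise_eq_of_mem _ _ _ hθ]

theorem isProbabilityMeasure_prior (hk : 1 ≤ k) (hR : 0 < R)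
    (hc : ContinuousOn (Model.point μ p) (Metric.closedBall 0 R)) :
    IsProbabilityMeasure (prior μ p R) := by
  constructor
  have h : ∀ m : Finset (Fin k), (uniformCube m R).map (Model.point μ p) univ = 1 := fun m => by
    have := isProbabilityMeasure_uniformCube m hR
    have := Measure.isProbabilityMeasure_map (aemeasurable_point hR.le hc m)
    exact measure_univ
  simp only [prior, Measure.finsetSum_apply, Measure.smul_apply, h, smul_eq_mul, mul_one]
  rw [← ENNReal.ofReal_sum_of_nonneg fun _ _ => (Real.exp_pos _).le, sum_exp_neg_penalty hk,
    ENNReal.ofReal_one]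

theorem ae_prior_mem_image (hp : ∀ θ, IsProbabilityMeasure (law μ p θ)) (hR : 0 < R)
    (hc : ContinuousOn (Model.point μ p) (Metric.closedBall 0 R)) :
    ∀ᵐ P ∂(prior μ p R), P ∈ Model.point μ p '' Metric.closedBall 0 R := by
  have := t2Space_model hp
  have hm : MeasurableSet (Model.point μ p '' Metric.closedBall 0 R) :=
    ((isCompact_closedBall _ _).image_of_continuousOn hc).isClosed.measurableSet
  have hz : ∀ m : Finset (Fin k), (uniformCube m R).map (Model.point μ p)
      (Model.point μ p '' Metric.closedBall 0 R)ᶜ = 0 := fun m => by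
    have h : ∀ᵐ P ∂((uniformCube m R).map (Model.point μ p)),
        P ∈ Model.point μ p '' Metric.closedBall 0 R := by
      refine (ae_map_iff (p := fun P => P ∈ Model.point μ p '' Metric.closedBall 0 R)
        (aemeasurable_point hR.le hc m) hm).2 ?_
      filter_upwards [ae_uniformCube_mem m hR.le] with θ hθ
      exact mem_image_of_mem _ hθ
    exact h
  rw [ae_iff]
  change prior μ p R (Model.point μ p '' Metric.closedBall 0 R)ᶜ = 0
  simp [prior, Measure.finsetSum_apply, hz]

theorem le_prior_apply (hk : 1 ≤ k)
    (hc : ContinuousOn (Model.point μ p) (Metric.closedBall 0 R)) {m : Finset (Fin k)} {δ : ℝ}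
    (hδ : 0 < δ) (hδR : δ ≤ R) {θ : Fin k → ℝ} (hθ : θ ∈ thetaCube m R) {A : Set (Model μ p)}
    (hA : MeasurableSet A) (hsub : ∀ θ', ‖θ'‖ ≤ R → ‖θ - θ'‖ ≤ δ → Model.point μ p θ' ∈ A) :
    ENNReal.ofReal (Real.exp (-(m.card * Real.log (2 * k * R / δ) + 1))) ≤ prior μ p R A := by
  have hk0 : (0 : ℝ) < k := by exact_mod_cast hk
  have hR : 0 < R := hδ.trans_le hδR
  calc ENNReal.ofReal (Real.exp (-(m.card * Real.log (2 * k * R / δ) + 1)))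
      ≤ ENNReal.ofReal (Real.exp (-penalty m)) * ENNReal.ofReal (δ / (2 * R)) ^ m.card := by
        rw [← ENNReal.ofReal_pow (by positivity), ← ENNReal.ofReal_mul (Real.exp_pos _).le]
        refine ENNReal.ofReal_le_ofReal ?_
        rw [← Real.exp_log (show 0 < δ / (2 * R) by positivity), ← Real.exp_nat_mul,
          ← Real.exp_add, Real.exp_le_exp]
        have h1 : Real.log (2 * k * R / δ) = Real.log k - Real.log (δ / (2 * R)) := by
          rw [← Real.log_div hk0.ne' (by positivity)]
          congr 1
          field_simp
        rw [h1]
        linarith [penalty_le hk m]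
    _ ≤ ENNReal.ofReal (Real.exp (-penalty m)) * (uniformCube m R).map (Model.point μ p) A := by
        gcongr
        rw [Measure.map_apply_of_aemeasurable (aemeasurable_point hR.le hc m) hA]
        exact (le_uniformCube hδ hδR hθ).trans (measure_mono fun θ' h => hsub θ' h.1 h.2)
    _ ≤ prior μ p R A := by
        rw [prior, Measure.finsetSum_apply]
        exact Finset.single_le_sum (f := fun m : Finset (Fin k) =>
          (ENNReal.ofReal (Real.exp (-penalty m)) • (uniformCube m R).map (Model.point μ p)) A)
          (fun _ _ => zero_le) (Finset.mem_univ m)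

end Prior

/-! ### Reduction to tests that are jointly measurable -/

section Congr

variable {E M : Type*} [MeasurableSpace M] {n : ℕ} {t t' : M → M → E → ℝ} {π : Measure M}
  {G : Set M}

theorem meanTestStat_congr (hG : ∀ᵐ P ∂π, P ∈ G)
    (h : ∀ P ∈ G, ∀ Q ∈ G, ∀ x, t P Q x = t' P Q x) (l : ℝ) (x : Fin n → E) {P : M}
    (hP : P ∈ G) : meanTestStat t π l x P = meanTestStat t' π l x P := by
  have hT : ∀ᵐ Q ∂π, testStat t x P Q = testStat t' x P Q := by
    filter_upwards [hG] with Q hQ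
    exact Finset.sum_congr rfl fun i _ => h P hP Q hQ (x i)
  rw [meanTestStat_eq_tilted, meanTestStat_eq_tilted,
    tilted_congr (g := fun Q => l * testStat t' x P Q)]
  · exact integral_congr_ae ((tilted_absolutelyContinuous _ _).ae_le hT)
  · filter_upwards [hT] with Q hQ
    rw [hQ]

theorem posterior_congr (hG : ∀ᵐ P ∂π, P ∈ G)
    (h : ∀ P ∈ G, ∀ Q ∈ G, ∀ x, t P Q x = t' P Q x) (β c : ℝ) (x : Fin n → E) :
    posterior t π β c x = posterior t' π β c x := by
  rw [posterior_eq_tilted, posterior_eq_tilted]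
  refine tilted_congr ?_
  filter_upwards [hG] with P hP
  rw [meanTestStat_congr hG h _ x hP]

theorem posterior_apply_congr (β c : ℝ) (x : Fin n → E) {A A' : Set M}
    (h : ∀ᵐ P ∂π, P ∈ A ↔ P ∈ A') : posterior t π β c x A = posterior t π β c x A' := by
  rw [posterior_eq_tilted]
  refine measure_congr ?_
  filter_upwards [(tilted_absolutelyContinuous _ _).ae_le h] with P hP
  exact propext hP

end Congr

/-! ### Tests built from a choice of parameter -/

section Model

variable {E : Type*} [MeasurableSpace E] {k : ℕ} {μ : Measure E} {p : (Fin k → ℝ) → E → ℝ≥0}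

/-- The test between the points of the model with parameters `σ P` and `σ Q`. -/
def selectedTest (p : (Fin k → ℝ) → E → ℝ≥0) (σ : Model μ p → Fin k → ℝ) (P Q : Model μ p)
    (x : E) : ℝ :=
  1 / 2 * contrast √(p (σ P) x : ℝ) √(p (σ Q) x : ℝ)

theorem measurable_selectedTest (hpm : Measurable fun z : E × (Fin k → ℝ) => p z.2 z.1)
    {σ : Model μ p → Fin k → ℝ} (hσ : Measurable σ) :
    Measurable fun z : Model μ p × Model μ p × E => selectedTest p σ z.1 z.2.1 z.2.2 := by
  have h1 : Measurable fun z : Model μ p × Model μ p × E => p (σ z.1) z.2.2 :=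
    hpm.comp (f := fun z : Model μ p × Model μ p × E => (z.2.2, σ z.1)) (by fun_prop)
  have h2 : Measurable fun z : Model μ p × Model μ p × E => p (σ z.2.1) z.2.2 :=
    hpm.comp (f := fun z : Model μ p × Model μ p × E => (z.2.2, σ z.2.1)) (by fun_prop)
  exact (measurable_contrast_sqrt h1 h2).const_mul _

theorem abs_selectedTest_le (σ : Model μ p → Fin k → ℝ) (P Q : Model μ p) (x : E) :
    |selectedTest p σ P Q x| ≤ 1 / 2 := by
  rw [selectedTest, abs_mul, abs_of_pos (by norm_num : (0 : ℝ) < 1 / 2)]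
  linarith [abs_contrast_sqrt_le_one (p (σ P) x : ℝ) (p (σ Q) x : ℝ)]

theorem selectedTest_antisymm (σ : Model μ p → Fin k → ℝ) (P Q : Model μ p) (x : E) :
    selectedTest p σ Q P x = -selectedTest p σ P Q x := by
  rw [selectedTest, selectedTest, contrast_antisymm, mul_neg]

theorem integral_selectedTest_le [SigmaFinite μ]
    (hpm : Measurable fun z : E × (Fin k → ℝ) => p z.2 z.1)
    (hp : ∀ θ, IsProbabilityMeasure (law μ p θ)) (σ : Model μ p → Fin k → ℝ) (S : Measure E)
    [IsProbabilityMeasure S] (P Q : Model μ p) :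
    ∫ x, selectedTest p σ P Q x ∂S ≤
        3 * sqHellinger S (law μ p (σ P)) - 1 / 4 * sqHellinger S (law μ p (σ Q)) ∧
      ∫ x, selectedTest p σ P Q x ^ 2 ∂S ≤
        sqHellinger S (law μ p (σ P)) + sqHellinger S (law μ p (σ Q)) := by
  have hpθ : ∀ θ, Measurable (p θ) := fun θ =>
    hpm.comp (f := fun x : E => (x, θ)) (by fun_prop)
  have h := integral_contrast_le (S := S) (μ := μ) (hpθ (σ P)) (hpθ (σ Q)) (hP := hp _)
    (hQ := hp _)
  simp only [selectedTest, mul_pow, integral_const_mul]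
  unfold law
  constructor <;> linarith [h.1, h.2]

/-- Equal laws have equal chosen densities, so the arbitrary parameter behind `Model.density` may be
replaced by any other, in particular by the measurable `σ P`. -/
theorem density_eq (hdens : ∀ θ θ', law μ p θ = law μ p θ' → p θ = p θ') {P : Model μ p}
    {θ : Fin k → ℝ} (h : Model.point μ p θ = P) : P.density = p θ := by
  subst h
  exact hdens _ _ (Model.point μ p θ).2.choose_spec

end Model

/-! ### The radius -/

section Radius

variable {E : Type*} [MeasurableSpace E] {k n : ℕ} {μ : Measure E} {p : (Fin k → ℝ) → E → ℝ≥0}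
  {R α B : ℝ}

theorem one_le_mul_rpow (hn : 1 ≤ n) (hR : 0 < R) (hα : 0 < α) (hB : 0 < B)
    (hRB : 1 ≤ R * B ^ (1 / (2 * α))) : 1 ≤ R * ((n : ℝ) * B) ^ (1 / (2 * α)) := by
  have hn' : (1 : ℝ) ≤ n := by exact_mod_cast hn
  refine hRB.trans (mul_le_mul_of_nonneg_left ?_ hR.le)
  exact Real.rpow_le_rpow hB.le (le_mul_of_one_le_left hB.le hn') (by positivity)

theorem log_radius_nonneg (hk : 1 ≤ k) (hn : 1 ≤ n) (hR : 0 < R) (hα : 0 < α) (hB : 0 < B)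
    (hRB : 1 ≤ R * B ^ (1 / (2 * α))) :
    0 ≤ Real.log (2 * k * R * ((n : ℝ) * B) ^ (1 / (2 * α))) := by
  have hk' : (1 : ℝ) ≤ k := by exact_mod_cast hk
  refine Real.log_nonneg ?_
  rw [mul_assoc]
  exact one_le_mul_of_one_le_of_one_le (by linarith) (one_le_mul_rpow hn hR hα hB hRB)

theorem exists_le_two_mul_radius (hk : 1 ≤ k) (hn : 1 ≤ n) (hR : 0 < R) (hα : 0 < α) (hB : 0 < B)
    (hRB : 1 ≤ R * B ^ (1 / (2 * α))) (Ps : Fin n → Measure E) {ξ : ℝ} (hξ : 0 < ξ) :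
    ∃ m : Finset (Fin k), ∃ θ ∈ thetaCube m R,
      sqHellinger (average Ps) (law μ p θ) +
        ((m.card : ℝ) * Real.log (2 * k * R * ((n : ℝ) * B) ^ (1 / (2 * α))) + ξ) / n ≤
      2 * radius μ p R α B Ps ξ := by
  have hn0 : (0 : ℝ) < n := by exact_mod_cast hn
  have hΛ := log_radius_nonneg hk hn hR hα hB hRB
  obtain ⟨m, hm⟩ := exists_eq_ciInf_of_finite (f := fun m : Finset (Fin k) =>
    ((⨅ θ : thetaCube m R, sqHellinger (average Ps) (law μ p θ.1)) +
      ((m.card : ℝ) * Real.log (2 * k * R * ((n : ℝ) * B) ^ (1 / (2 * α))) + ξ) / n))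
  have : Nonempty (thetaCube m R) := ⟨⟨0, fun _ _ => rfl, by simpa using hR.le⟩⟩
  -- No minimiser over `θ` is needed: a slack of `ξ/n` is absorbed by the factor `2`, which doubles
  -- the term `ξ/n` of the radius.
  obtain ⟨θ, hθ⟩ := exists_lt_of_ciInf_lt
    (f := fun θ : thetaCube m R => sqHellinger (average Ps) (law μ p θ.1))
    (lt_add_of_pos_right _ (div_pos hξ hn0))
  have h0 : 0 ≤ ⨅ θ : thetaCube m R, sqHellinger (average Ps) (law μ p θ.1) :=
    le_ciInf fun θ => sqHellinger_nonneg _ _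
  have h1 : 0 ≤ (m.card : ℝ) * Real.log (2 * k * R * ((n : ℝ) * B) ^ (1 / (2 * α))) / n := by
    positivity
  refine ⟨m, θ, θ.2, ?_⟩
  rw [radius, ← hm]
  rw [add_div]
  linarith

/-- The radius `(nB)^(-1/(2α))` is the one for which `√B δ^α = n^(-1/2)`. -/
theorem sqHellinger_law_le (hn : 1 ≤ n) (hα : 0 < α) (hB : 0 < B)
    (hH : ∀ θ θ' : Fin k → ℝ, ‖θ‖ ≤ R → ‖θ'‖ ≤ R →
      hellinger (law μ p θ) (law μ p θ') ≤ √B * ‖θ - θ'‖ ^ α)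
    {θ θ' : Fin k → ℝ} (hθ : ‖θ‖ ≤ R) (hθ' : ‖θ'‖ ≤ R)
    (h : ‖θ - θ'‖ ≤ (((n : ℝ) * B) ^ (1 / (2 * α)))⁻¹) :
    sqHellinger (law μ p θ) (law μ p θ') ≤ 1 / n := by
  have hn0 : (0 : ℝ) < n := by exact_mod_cast hn
  have hnB : 0 < (n : ℝ) * B := mul_pos hn0 hB
  have h1 : ((((n : ℝ) * B) ^ (1 / (2 * α)))⁻¹) ^ α = (√((n : ℝ) * B))⁻¹ := by
    rw [Real.inv_rpow (by positivity), ← Real.rpow_mul hnB.le, Real.sqrt_eq_rpow]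
    congr 2
    field_simp
  have h2 : hellinger (law μ p θ) (law μ p θ') ≤ √B * (√((n : ℝ) * B))⁻¹ := by
    refine (hH θ θ' hθ hθ').trans (mul_le_mul_of_nonneg_left ?_ (Real.sqrt_nonneg B))
    rw [← h1]
    exact Real.rpow_le_rpow (norm_nonneg _) h hα.le
  rw [← hellinger_sq]
  refine (pow_le_pow_left₀ (Real.sqrt_nonneg _) h2 2).trans (le_of_eq ?_)
  rw [mul_pow, inv_pow, Real.sq_sqrt hB.le, Real.sq_sqrt hnB.le]
  field_simp

end Radius

end SparsePosterior

end

/-! ### The posterior concentration bound -/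

open SparsePosterior in
theorem corollary4 :
    ∃ κ : ℝ, 0 < κ ∧
      ∀ (E : Type*) [MeasurableSpace E] (μ : Measure E) [SigmaFinite μ]
        (k n : ℕ) (_ : 1 ≤ k) (_ : 1 ≤ n)
        (p : (Fin k → ℝ) → E → ℝ≥0)
        -- joint measurability of `(x, θ) ↦ p_θ(x)`
        (_ : Measurable fun z : E × (Fin k → ℝ) => p z.2 z.1)
        -- each `P_θ = p_θ · μ` is a probability
        (_ : ∀ θ, IsProbabilityMeasure (SparsePosterior.law μ p θ))
        -- the density attached to a point of the model depends on that point only, so that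
        -- `t_(P,Q)` is well defined for `P`, `Q` in the model
        (_ : ∀ θ θ', SparsePosterior.law μ p θ = SparsePosterior.law μ p θ' → p θ = p θ')
        (R α B : ℝ) (_ : 0 < R) (_ : 0 < α) (_ : α ≤ 1) (_ : 0 < B)
        (_ : ∀ θ θ' : Fin k → ℝ, ‖θ‖ ≤ R → ‖θ'‖ ≤ R →
          SparsePosterior.hellinger (SparsePosterior.law μ p θ) (SparsePosterior.law μ p θ')
            ≤ √B * ‖θ - θ'‖ ^ α)
        (_ : 1 ≤ R * B ^ (1 / (2 * α))),
        IsProbabilityMeasure (SparsePosterior.prior μ p R) ∧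
        (∀ x : Fin n → E, IsProbabilityMeasure
          (SparsePosterior.posterior SparsePosterior.hellingerTest
            (SparsePosterior.prior μ p R) (1 / 500) (1 / 125) x)) ∧
        ∀ (Ps : Fin n → Measure E) (_ : ∀ i, IsProbabilityMeasure (Ps i)) (ξ : ℝ) (_ : 0 < ξ),
          Measurable (fun x : Fin n → E =>
            SparsePosterior.posterior SparsePosterior.hellingerTest
              (SparsePosterior.prior μ p R) (1 / 500) (1 / 125) x
              (SparsePosterior.hBall μ p (SparsePosterior.average Ps)
                (κ * SparsePosterior.radius μ p R α B Ps ξ))ᶜ) ∧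
          ∫⁻ x : Fin n → E,
            SparsePosterior.posterior SparsePosterior.hellingerTest
              (SparsePosterior.prior μ p R) (1 / 500) (1 / 125) x
              (SparsePosterior.hBall μ p (SparsePosterior.average Ps)
                (κ * SparsePosterior.radius μ p R α B Ps ξ))ᶜ
            ∂(Measure.pi Ps)
          ≤ ENNReal.ofReal (2 * Real.exp (-ξ)) := by
  -- A generous value: `100000/(500 · 5) = 40`, so the negative term in the exponent is `-40 n r`,
  -- at most `-20(n h²(P̄*, P_θ) + L + ξ)`, where `L` is the dimension term for the selected `m` and
  -- `θ`.
  refine ⟨100000, by norm_num, ?_⟩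
  intro E _ μ _ k n hk hn p hpm hp hdens R α B hR hα _ hB hH hRB
  have hc := continuousOn_point hα hH
  have := t2Space_model hp
  have := isProbabilityMeasure_prior hk hR hc
  obtain ⟨σ, hσm, -, hσ⟩ := exists_measurable_section (isCompact_closedBall 0 R)
    ⟨0, Metric.mem_closedBall_self hR.le⟩ hc
  have hG := ae_prior_mem_image hp hR hc
  have htest : ∀ P ∈ Model.point μ p '' Metric.closedBall 0 R,
      ∀ Q ∈ Model.point μ p '' Metric.closedBall 0 R, ∀ x,
        hellingerTest P Q x = selectedTest p σ P Q x := fun P hP Q hQ x => by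
    rw [hellingerTest_eq, selectedTest, density_eq hdens (hσ P hP), density_eq hdens (hσ Q hQ)]
  have htm := measurable_selectedTest hpm hσm
  have htb := abs_selectedTest_le σ
  have hpost : ∀ x : Fin n → E, posterior hellingerTest (prior μ p R) (1 / 500) (1 / 125) x =
      posterior (selectedTest p σ) (prior μ p R) (1 / 500) (1 / 125) x :=
    fun x => posterior_congr hG htest _ _ x
  have hprob : ∀ x : Fin n → E, IsProbabilityMeasure
      (posterior (selectedTest p σ) (prior μ p R) (1 / 500) (1 / 125) x) :=
    fun x => isProbabilityMeasure_posterior htm htb _ _ x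
  simp only [hpost]
  refine ⟨inferInstance, hprob, fun Ps hPs ξ hξ => ?_⟩
  have hS := isProbabilityMeasure_average hn Ps
  set r := radius μ p R α B Ps ξ
  have hlaw : ∀ P ∈ Model.point μ p '' Metric.closedBall 0 R, law μ p (σ P) = P.toMeasure :=
    fun P hP => congrArg Subtype.val (hσ P hP)
  have hℓm : Measurable fun P : Model μ p => sqHellinger (average Ps) (law μ p (σ P)) :=
    (measurable_sqHellinger_law hpm hp (average Ps)).comp hσm
  have hA : MeasurableSet
      {P : Model μ p | 100000 * r < sqHellinger (average Ps) (law μ p (σ P))} :=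
    measurableSet_lt measurable_const hℓm
  -- Outside the ball, `h²(P̄*, ·)` is read through `σ`, which gives a Borel set agreeing with the
  -- complement of `hBall` up to a null set of the prior.
  have hset : ∀ x : Fin n → E,
      posterior (selectedTest p σ) (prior μ p R) (1 / 500) (1 / 125) x
        (hBall μ p (average Ps) (100000 * r))ᶜ =
      posterior (selectedTest p σ) (prior μ p R) (1 / 500) (1 / 125) x
        {P : Model μ p | 100000 * r < sqHellinger (average Ps) (law μ p (σ P))} := fun x => by
    refine posterior_apply_congr _ _ x ?_
    filter_upwards [hG] with P hP
    rw [mem_compl_iff, hBall, mem_ofPred_eq, not_le, hlaw P hP]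
  simp only [hset]
  refine ⟨measurable_posterior_apply htm htb _ _ hA, ?_⟩
  -- For `ξ ≤ log 2` the bound `2 exp(-ξ) ≥ 1` is trivial; otherwise `ξ` is bounded below and
  -- absorbs the additive constants `6` and `28/500` in the exponent.
  rcases le_total ξ (Real.log 2) with hξ2 | hξ2
  · refine (lintegral_mono fun x => prob_le_one).trans ?_
    rw [lintegral_one, measure_univ, ENNReal.one_le_ofReal]
    have h := Real.exp_le_exp.2 (neg_le_neg hξ2)
    rw [Real.exp_neg, Real.exp_log two_pos] at h
    linarith
  · have hn0 : (0 : ℝ) < n := by exact_mod_cast hn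
    obtain ⟨m, θ, hθ, hθr⟩ := exists_le_two_mul_radius (μ := μ) (p := p) hk hn hR hα hB hRB Ps hξ
    have hΛ := log_radius_nonneg hk hn hR hα hB hRB
    have hD : 0 < ((n : ℝ) * B) ^ (1 / (2 * α)) := by positivity
    -- The condition `R B_k^(1/(2α)) ≥ 1` gives `δ ≤ R`. The set is a loss ball of radius `r₀ = 2
    -- h²(P̄*, P_θ) + 2/n`, by the weak triangle inequality for `h²`.
    have hmass := le_prior_apply hk hc (inv_pos.2 hD)
      ((inv_le_iff_one_le_mul₀ hD).2 (one_le_mul_rpow hn hR hα hB hRB)) hθ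
      (A := {P : Model μ p | sqHellinger (average Ps) (law μ p (σ P)) ≤
        2 * sqHellinger (average Ps) (law μ p θ) + 2 * (1 / n)})
      (measurableSet_le hℓm measurable_const) fun θ' hθ' hd => by
        have hmem := mem_image_of_mem (Model.point μ p) (mem_closedBall_zero_iff.2 hθ')
        rw [mem_ofPred_eq, hlaw _ hmem]
        have := hp θ
        have : IsProbabilityMeasure (Model.point μ p θ').toMeasure := hp θ'
        refine (sqHellinger_le_two_mul_add _ (law μ p θ) _).trans ?_
        gcongr
        exact sqHellinger_law_le hn hα hB hH hθ.2 hθ' hd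
    rw [div_inv_eq_mul] at hmass
    refine lintegral_posterior_le hn htm htb (selectedTest_antisymm σ)
      (fun P => sqHellinger_nonneg _ _)
      (fun P Q => (integral_selectedTest_le hpm hp σ _ P Q).1)
      (fun P Q => (integral_selectedTest_le hpm hp σ _ P Q).2)
      hA (measurableSet_le hℓm measurable_const) (fun P hP => le_of_lt hP) (fun Q hQ => hQ)
      (by have := sqHellinger_nonneg (average Ps) (law μ p θ); positivity) hmass ?_
    have h0 := sqHellinger_nonneg (average Ps) (law μ p θ)
    have hlog := Real.log_two_gt_d9
    have hm0 := mul_nonneg (Nat.cast_nonneg m.card : (0 : ℝ) ≤ m.card) hΛ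
    generalize (m.card : ℝ) * Real.log (2 * k * R * ((n : ℝ) * B) ^ (1 / (2 * α))) = L at *
    generalize sqHellinger (average Ps) (law μ p θ) = ρ at *
    have h1 : n * ρ + L + ξ ≤ 2 * (n * r) := by
      have := mul_le_mul_of_nonneg_left hθr hn0.le
      rw [mul_add, mul_div_cancel₀ _ hn0.ne'] at this
      linarith
    have h2 : (n : ℝ) / 500 * (14 * (2 * ρ + 2 * (1 / n)) - 100000 * r / 5) =
        28 / 500 * (n * ρ) + 28 / 500 - 40 * (n * r) := by
      field_simp
      ring
    rw [h2]
    nlinarith [mul_nonneg hn0.le h0]
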